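/- An Abelian group HBL datum $\mathfrak G=(G,(G_1,\dots,G_m),(\phi_1,\dots,\phi_m))$ consists of a finitely generated torsion-free Abelian group $G$, finitely generated Abelian groups $G_1,\dots,G_m$, and group homomorphisms $\phi_j\colon G\to G_j$. As input to an algorithm it is given by the rank $d$ of $G\cong\mathbb Z^d$ and, for each $j$, a finite presentation of $G_j$ by generators and relations together with an integer matrix representing $\phi_j$. A tuple $(r,r_1,\dots,r_m)$ of natural numbers is realized by a subgroup $H\le G$ if $\operatorname{rank}(H)=r$ and $\operatorname{rank}(\phi_j(H))=r_j$ for all $j$. (1) There is an algorithm which, given any Abelian group HBL datum $\mathfrak G$, computes the (finite) set of all tuples $(r,r_1,\dots,r_m)$ realized by subgroups of $G$ (equivalently, the set of all constraints $\operatorname{rank}(H)\le\sum_j s_j\operatorname{rank}(\phi_j(H))$, $H\le G$), if and only if Hilbert's Tenth Problem over $\mathbb Q$ is decidable, that is, there is an algorithm which decides whether any given finite system of polynomial equations $f_1=\dots=f_p=0$ with $f_i\in\mathbb Q[x_1,\dots,x_q]$ has a solution in $\mathbb Q^q$. (2) Moreover, basic Diophantine systems are encoded by explicit integer matrices, as follows.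 Let $q=t+s$ and let $S\subset\mathbb Q[x_1,\dots,x_q]$ be a basic system, consisting of $\ell$ affine polynomials $\lambda_{0,j}+\sum_{i=1}^q\lambda_{i,j}x_i$ and $k$ polynomials $x_{i_{1,j}}x_{i_{2,j}}-x_{i_{3,j}}$; let $\tilde\lambda_{i,j}\in\mathbb Z$ be the coefficients of the $j$-th affine polynomial multiplied by a positive common denominator. Write $(u_0,\dots,u_q;v_0,\dots,v_q)$ for the coordinates on $\mathbb Z^{2q+2}$. For $a=(p_1/q_1,\dots,p_t/q_t)\in\mathbb Q^t$, with $p_j\in\mathbb Z$ and $q_j\ge 1$ integers, consider the following $4+q+k+t+\ell$ endomorphisms of $\mathbb Z^{2q+2}$: $(u;v)\mapsto(u_0,0,\dots,0)$; $(u;v)\mapsto(v_0,0,\dots,0)$; $(u;v)\mapsto(u_0,\dots,u_q;0,\dots,0)$; $(u;v)\mapsto(v_0,\dots,v_q;0,\dots,0)$; $(u;v)\mapsto(u_0-v_0,u_j-v_j,0,\dots,0)$ for $1\le j\le q$; $(u;v)\mapsto(u_{i_{1,j}}+v_0,\,u_{i_{3,j}}+v_{i_{2,j}},0,\dots,0)$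 for $1\le j\le k$; $(u;v)\mapsto(p_ju_0-q_ju_j,0,\dots,0)$ for $1\le j\le t$; $(u;v)\mapsto(\sum_{i=0}^q\tilde\lambda_{i,j}u_i,0,\dots,0)$ for $1\le j\le\ell$. For each fixed $S$ their matrices are computable functions of the pairs $(p_j,q_j)_{1\le j\le t}$, and there is $b\in\mathbb Q^s$ such that $(a,b)$ is a common zero of $S$ if and only if there is a subgroup $H\le\mathbb Z^{2q+2}$ of rank $2$ whose images under the first $4+q+k$ of these maps have rank $1$ and whose images under the last $t+\ell$ have rank $0$. -/

import Mathlib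

namespace HBL

/-! ### Abelian group HBL data and the rank tuples realized by subgroups -/

/-- An Abelian group Hölder–Brascamp–Lieb datum: a finitely generated torsion-free Abelian group
`G`, finitely generated Abelian groups `G₁, …, G_m` (possibly with torsion), and homomorphisms
`φ_j : G → G_j`. -/
structure Datum where
  m : ℕ
  G : Type
  [groupG : AddCommGroup G]
  [fgG : AddGroup.FG G]
  [torsionFreeG : IsAddTorsionFree G]
  target : Fin m → Type
  [groupTarget : ∀ j, AddCommGroup (target j)]
  [fgTarget : ∀ j, AddGroup.FG (target j)]
  φ : ∀ j, G →+ target j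

attribute [instance] Datum.groupG Datum.fgG Datum.torsionFreeG Datum.groupTarget Datum.fgTarget

/-- The set of all `(r, r₁, …, r_m)` for which some subgroup `H ≤ G` satisfies `rank H = r` and
`rank φ_j(H) = r_j` for all `j`. -/
def Datum.rankTuples (𝔊 : Datum) : Set (ℕ × (Fin 𝔊.m → ℕ)) :=
  {p | ∃ H : AddSubgroup 𝔊.G, Module.finrank ℤ H = p.1 ∧
    ∀ j, Module.finrank ℤ (H.map (𝔊.φ j)) = p.2 j}

/-! ### Finite codes for HBL data -/

/-- The vector in `ℤⁿ` with the listed coordinates (padded with zeros, or truncated). -/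
def vec (n : ℕ) (l : List ℤ) : Fin n → ℤ := fun i => l.getD i 0

/-- The `a × b` integer matrix with the listed rows (padded with zeros, or truncated). -/
def mat (a b : ℕ) (M : List (List ℤ)) : Matrix (Fin a) (Fin b) ℤ :=
  Matrix.of fun i => vec b (M.getD i [])

/-- A code for one target group together with the homomorphism into it: the number `n` of
generators, a finite list of relations in `ℤⁿ`, and the rows of an integer matrix. -/
abbrev TargetCode := ℕ × List (List ℤ) × List (List ℤ)

/-- The subgroup of `ℤⁿ` generated by the relations. -/
def TargetCode.relations (c : TargetCode) : AddSubgroup (Fin c.1 → ℤ) :=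
  AddSubgroup.closure {v | ∃ l ∈ c.2.1, v = vec c.1 l}

/-- The finitely presented Abelian group `ℤⁿ / ⟨relations⟩`. -/
abbrev TargetCode.Group (c : TargetCode) : Type := (Fin c.1 → ℤ) ⧸ c.relations

/-- The homomorphism `ℤᵈ → ℤⁿ / ⟨relations⟩` induced by the coded matrix. -/
def TargetCode.hom (d : ℕ) (c : TargetCode) : (Fin d → ℤ) →+ c.Group :=
  (QuotientAddGroup.mk' c.relations).comp (mat c.1 d c.2.2).mulVecLin.toAddMonoidHom

/-- A code for an HBL datum: the rank `d` of `G = ℤᵈ`, and the list of the codes of the targets. -/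
abbrev DatumCode := ℕ × List TargetCode

/-- The datum described by a code. -/
def DatumCode.toDatum (c : DatumCode) : Datum where
  m := c.2.length
  G := Fin c.1 → ℤ
  fgG := Module.Finite.iff_addGroup_fg.1 inferInstance
  target := fun j => (c.2.get j).Group
  fgTarget := fun _ => Module.Finite.iff_addGroup_fg.1 inferInstance
  φ := fun j => (c.2.get j).hom c.1

theorem vec_ofFn {n : ℕ} (v : Fin n → ℤ) : vec n (List.ofFn v) = v := by
  funext i
  simp [vec]

theorem mat_ofFn {a b : ℕ} (M : Matrix (Fin a) (Fin b) ℤ) :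
    mat a b (List.ofFn fun i => List.ofFn (M i)) = M := by
  ext i j
  simp [mat, vec]

theorem TargetCode.exists_code {d : ℕ} {A : Type} [AddCommGroup A] [AddGroup.FG A]
    (f : (Fin d → ℤ) →+ A) :
    ∃ (c : TargetCode) (e : c.Group ≃+ A), ∀ x, e (c.hom d x) = f x := by
  have : Module.Finite ℤ A := Module.Finite.iff_addGroup_fg.2 inferInstance
  obtain ⟨n, p, hp⟩ := Module.Finite.exists_fin' ℤ A
  obtain ⟨s, hs⟩ := IsNoetherian.noetherian (LinearMap.ker p)
  choose g hg using hp
  set M : Matrix (Fin n) (Fin d) ℤ := Matrix.of fun i k => g (f (Pi.single k 1)) i with hM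
  let c : TargetCode :=
    (n, s.toList.map (fun v => List.ofFn v), List.ofFn fun i => List.ofFn (M i))
  have hset : {v | ∃ l ∈ c.2.1, v = vec c.1 l} = (s : Set (Fin n → ℤ)) := by
    ext v
    simp only [c, List.mem_map, Finset.mem_toList, Set.mem_ofPred_eq, Finset.mem_coe]
    constructor
    · rintro ⟨_, ⟨w, hw, rfl⟩, rfl⟩
      rwa [vec_ofFn]
    · intro hv
      exact ⟨_, ⟨v, hv, rfl⟩, (vec_ofFn v).symm⟩
  have hrel : c.relations = p.toAddMonoidHom.ker := by
    have h1 := congrArg Submodule.toAddSubgroup hs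
    rw [Submodule.span_int_eq_addSubgroupClosure] at h1
    unfold TargetCode.relations
    rw [hset]
    ext v
    rw [h1]
    rfl
  let e : c.Group ≃+ A := (QuotientAddGroup.quotientAddEquivOfEq hrel).trans
    (QuotientAddGroup.quotientKerEquivOfSurjective p.toAddMonoidHom fun y => ⟨g y, hg y⟩)
  refine ⟨c, e, fun x => ?_⟩
  have h2 : e (c.hom d x) = p (M.mulVecLin x) := by
    have : mat c.1 d c.2.2 = M := mat_ofFn M
    change p ((mat c.1 d c.2.2).mulVecLin x) = _
    rw [this]
  rw [h2]
  have h3 : p ∘ₗ M.mulVecLin = f.toIntLinearMap := by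
    refine (Pi.basisFun ℤ (Fin d)).ext fun k => ?_
    have h4 : M.mulVecLin (Pi.single k 1) = g (f (Pi.single k 1)) := by
      funext i
      simp [hM]
    simp only [Pi.basisFun_apply, LinearMap.comp_apply, h4, hg]
    rfl
  exact LinearMap.congr_fun h3 x

/-- Every HBL datum is isomorphic to one that is described by a code. -/
theorem DatumCode.exists_code (𝔊 : Datum) :
    ∃ (c : DatumCode) (hm : c.toDatum.m = 𝔊.m) (e : c.toDatum.G ≃+ 𝔊.G)
      (e' : ∀ j, c.toDatum.target j ≃+ 𝔊.target (j.cast hm)),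
      ∀ j x, e' j (c.toDatum.φ j x) = 𝔊.φ (j.cast hm) (e x) := by
  have : Module.Finite ℤ 𝔊.G := Module.Finite.iff_addGroup_fg.2 inferInstance
  let b := Module.finBasis ℤ 𝔊.G
  set d := Module.finrank ℤ 𝔊.G
  let e : (Fin d → ℤ) ≃+ 𝔊.G := b.equivFun.symm.toAddEquiv
  choose c e' h using fun j => TargetCode.exists_code ((𝔊.φ j).comp e.toAddMonoidHom)
  have hget : ∀ j, (List.ofFn c).get j = c (j.cast (by simp)) := fun j => by
    simp only [List.get_ofFn]
  let ec : ∀ x y : TargetCode, x = y → (x.Group ≃+ y.Group) := fun x y hxy => hxy ▸ AddEquiv.refl _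
  have hec : ∀ x y (hxy : x = y) v, ec x y hxy (x.hom d v) = y.hom d v := by
    rintro x _ rfl v
    rfl
  refine ⟨(d, List.ofFn c), by simp [DatumCode.toDatum], e,
    fun j => (ec _ _ (hget j)).trans (e' _), fun j x => ?_⟩
  exact (congrArg (e' _) (hec _ _ (hget j) x)).trans (h _ x)

/-- There is an algorithm that, given any (coded) HBL datum `𝔊`, outputs the finite list of all
tuples `(r, r₁, …, r_m)` that are realized by subgroups of `G`. -/
def RankTuplesComputable : Prop :=
  ∃ F : DatumCode → List (ℕ × List ℕ), Computable F ∧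
    ∀ c : DatumCode, {x | x ∈ F c} =
      (fun p : ℕ × (Fin c.toDatum.m → ℕ) => (p.1, List.ofFn p.2)) '' c.toDatum.rankTuples

/-! ### Hilbert's Tenth Problem over `ℚ` -/

/-- The set `V(S)(ℚ)` of rational common zeros of a set `S ⊆ ℚ[x₁, …, x_q]`. -/
def rationalZeros {q : ℕ} (S : Set (MvPolynomial (Fin q) ℚ)) : Set (Fin q → ℚ) :=
  {a | ∀ f ∈ S, MvPolynomial.eval a f = 0}

/-- A rational number, coded as a fraction with positive denominator. -/
abbrev RatCode := ℤ × ℕ+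

def RatCode.toRat (c : RatCode) : ℚ := (c.1 : ℚ) / ((c.2 : ℕ) : ℚ)

/-- A polynomial, coded as a list of terms, each a coefficient with a list of exponents. -/
abbrev PolyCode := List (RatCode × List ℕ)

/-- The polynomial in `q` variables described by a code (missing exponents are zero). -/
noncomputable def PolyCode.toPoly (q : ℕ) (c : PolyCode) : MvPolynomial (Fin q) ℚ :=
  (c.map fun t => MvPolynomial.C (RatCode.toRat t.1) *
    ∏ i : Fin q, MvPolynomial.X i ^ t.2.getD i 0).sum

/-- Hilbert's Tenth Problem over `ℚ` is decidable: there is an algorithm that, given `q` and a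
finite list of polynomials in `ℚ[x₁, …, x_q]`, decides whether they have a common rational zero. -/
def HilbertTenthRatDecidable : Prop :=
  ComputablePred fun s : ℕ × List PolyCode =>
    (rationalZeros {f | ∃ c ∈ s.2, f = PolyCode.toPoly s.1 c}).Nonempty

/-! ### Basic Diophantine systems and their encoding by integer matrices -/

/-- A basic system in `q` variables: `l` affine polynomials `λ₀ + ∑ λᵢ xᵢ` with rational
coefficients, and `k` polynomials of the form `x_{i₁} x_{i₂} - x_{i₃}`. -/
structure BasicSystem (q k l : ℕ) where
  const : Fin l → ℚ
  coeff : Fin l → Fin q → ℚ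
  i₁ : Fin k → Fin q
  i₂ : Fin k → Fin q
  i₃ : Fin k → Fin q

namespace BasicSystem

variable {q k l : ℕ}

/-- The polynomials of a basic system. -/
noncomputable def polys (S : BasicSystem q k l) : Set (MvPolynomial (Fin q) ℚ) :=
  Set.range (fun j : Fin l =>
      MvPolynomial.C (S.const j) + ∑ i, MvPolynomial.C (S.coeff j i) * MvPolynomial.X i) ∪
    Set.range (fun j : Fin k =>
      MvPolynomial.X (S.i₁ j) * MvPolynomial.X (S.i₂ j) - MvPolynomial.X (S.i₃ j))

/-- A positive common denominator of the coefficients of the `j`-th affine polynomial. -/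
def commonDen (S : BasicSystem q k l) (j : Fin l) : ℕ :=
  (S.const j).den * ∏ i, (S.coeff j i).den

/-- The coefficients `λ₀, λ₁, …, λ_q` of the `j`-th affine polynomial, scaled to integers. -/
def intCoeff (S : BasicSystem q k l) (j : Fin l) : Fin (q + 1) → ℤ :=
  Fin.cons ((S.commonDen j : ℚ) * S.const j).num fun i => ((S.commonDen j : ℚ) * S.coeff j i).num

end BasicSystem

/-- The set of all tuples of integer matrices `φᵢ`, acting on `ℤⁿ`, for which some subgroup
`H ≤ ℤⁿ` satisfies `rank H = r` and `rank φᵢ(H) = ρᵢ` for all `i`. -/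
def matrixRealizers {n ι : Type} [Fintype n] (r : ℕ) (ρ : ι → ℕ) : Set (ι → Matrix n n ℤ) :=
  {φ | ∃ H : AddSubgroup (n → ℤ), Module.finrank ℤ H = r ∧
    ∀ i, Module.finrank ℤ (H.map (φ i).mulVecLin.toAddMonoidHom) = ρ i}

/-- The coordinates `(u₀, …, u_q; v₀, …, v_q)` of `ℤ^{2q+2}`. -/
abbrev Coord (q : ℕ) := Fin (q + 1) ⊕ Fin (q + 1)

/-- The coordinate functional `u_i`, as a row vector. -/
def rowU {q : ℕ} (i : Fin (q + 1)) : Coord q → ℤ := Pi.single (Sum.inl i) 1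

/-- The coordinate functional `v_i`, as a row vector. -/
def rowV {q : ℕ} (i : Fin (q + 1)) : Coord q → ℤ := Pi.single (Sum.inr i) 1

/-- The matrix of `w ↦ (x(w), 0, …, 0)`. -/
def oneRow {q : ℕ} (x : Coord q → ℤ) : Matrix (Coord q) (Coord q) ℤ :=
  Matrix.of fun r => if r = Sum.inl 0 then x else 0

/-- The matrix of `w ↦ (x(w), y(w), 0, …, 0)` (used only for `q ≥ 1`). -/
def twoRows {q : ℕ} (x y : Coord q → ℤ) : Matrix (Coord q) (Coord q) ℤ :=
  Matrix.of fun r => if r = Sum.inl 0 then x else if r = Sum.inl 1 then y else 0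

/-- The indices of the `4 + q + k + t + l` matrices. -/
inductive MatrixIndex (q k t l : ℕ)
  | u₀
  | v₀
  | u
  | v
  | eq (j : Fin q)
  | mul (j : Fin k)
  | param (j : Fin t)
  | affine (j : Fin l)

/-- The ranks prescribed for the images: ones, followed by zeros for the last `t + l` matrices. -/
def MatrixIndex.rank {q k t l : ℕ} : MatrixIndex q k t l → ℕ
  | .param _ => 0
  | .affine _ => 0
  | _ => 1

/-- The integer matrices that encode the basic system `S` in the variables
`x₁, …, x_t, y₁, …, y_s` at the parameter `a = (p₁/q₁, …, p_t/q_t)`. -/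
def BasicSystem.matrices {t s k l : ℕ} (S : BasicSystem (t + s) k l) (a : Fin t → RatCode) :
    MatrixIndex (t + s) k t l → Matrix (Coord (t + s)) (Coord (t + s)) ℤ
  | .u₀ => oneRow (rowU 0)
  | .v₀ => oneRow (rowV 0)
  | .u => Matrix.of (Sum.elim (fun i => rowU i) fun _ => 0)
  | .v => Matrix.of (Sum.elim (fun i => rowV i) fun _ => 0)
  | .eq j => twoRows (rowU 0 - rowV 0) (rowU j.succ - rowV j.succ)
  | .mul j => twoRows (rowU (S.i₁ j).succ + rowV 0) (rowU (S.i₃ j).succ + rowV (S.i₂ j).succ)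
  | .param j => oneRow ((a j).1 • rowU 0 - ((a j).2 : ℤ) • rowU (Fin.castAdd s j).succ)
  | .affine j => oneRow (∑ i, S.intCoeff j i • rowU i)

end HBL

/-! ### Closure properties of primitive recursive functions, for `fun_prop` -/

-- Both decision problems are compared with solvability over ℚ of sparse systems: integer
-- coefficients, monomials written as words in the variables. Hilbert's Tenth Problem over ℚ reduces
-- to this form and back by primitive recursive maps (`hilbertTenthRatDecidable_iff_sparse`).
--
-- Ranks encode equations as follows. Let `H` have rank two in a group with coordinates (u, v). If
-- the u-image and the v-image have rank one, and so do those of u_o and v_o, then u = αx and v = βy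
-- on `H` for fixed rational vectors with x_o = y_o = 1, and rank two gives two elements whose pairs
-- (α, β) have non-zero determinant Δ. A map of rank one has vanishing 2 × 2 minors. For (u_o - v_o,
-- u_j - v_j) the minor is Δ(x_j - y_j), so y = x; for (u_a + v_o, u_c + v_b) it is Δ(x_a x_b -
-- x_c), so multiplication is expressed. Images of rank zero express linear equations. Conversely, a
-- solution x with common denominator D yields the span of (Dx, 0) and (0, Dx). This is
-- `EncodesSolution.exists_solution` and `exists_encodesSolution`; it gives the explicit matrices
-- directly. For an arbitrary sparse system, every word with code up to a bound becomes an unknown,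
-- equal to the product of its first letter and its tail, and the polynomials become linear
-- (`sparseSolvable_iff_exists_monomials`).
--
-- In the other direction, rank φ(H) is the dimension of the image of the rational span of `H` in ℚⁿ
-- modulo the span of the relations (`TargetCode.imageRank_eq`). Such a span is the column space of
-- a matrix with a left inverse, and the dimension of the image is certified by a matrix
-- factorization (`TargetCode.imageRank_eq_iff`), so a tuple is realized exactly when a computable
-- polynomial system is solvable. All ranks are at most d, hence finitely many candidate tuples need
-- testing.

attribute [fun_prop] Primrec
attribute [fun_prop] Primrec.id Primrec.const Primrec.comp Primrec.pair Primrec.fst Primrec.snd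
  Primrec.succ

namespace HBL

section Primrec

variable {α β γ σ : Type*} [Primcodable α] [Primcodable β] [Primcodable γ] [Primcodable σ]

@[fun_prop]
theorem primrec_fst {f : α → β × γ} (hf : Primrec f) : Primrec fun a => (f a).1 :=
  Primrec.fst.comp hf

@[fun_prop]
theorem primrec_snd {f : α → β × γ} (hf : Primrec f) : Primrec fun a => (f a).2 :=
  Primrec.snd.comp hf

@[fun_prop]
theorem primrec_add {f g : α → ℕ} (hf : Primrec f) (hg : Primrec g) :
    Primrec fun a => f a + g a :=
  Primrec.nat_add.comp hf hg

@[fun_prop]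
theorem primrec_mul {f g : α → ℕ} (hf : Primrec f) (hg : Primrec g) :
    Primrec fun a => f a * g a :=
  Primrec.nat_mul.comp hf hg

@[fun_prop]
theorem primrec_sub {f g : α → ℕ} (hf : Primrec f) (hg : Primrec g) :
    Primrec fun a => f a - g a :=
  Primrec.nat_sub.comp hf hg

@[fun_prop]
theorem primrec_natPair {f g : α → ℕ} (hf : Primrec f) (hg : Primrec g) :
    Primrec fun a => Nat.pair (f a) (g a) :=
  Primrec₂.natPair.comp hf hg

@[fun_prop]
theorem primrec_natUnpair {f : α → ℕ} (hf : Primrec f) : Primrec fun a => Nat.unpair (f a) :=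
  Primrec.unpair.comp hf

@[fun_prop]
theorem primrec_encode {f : α → β} (hf : Primrec f) : Primrec fun a => Encodable.encode (f a) :=
  Primrec.encode.comp hf

@[fun_prop]
theorem primrec_ite_eq {f g : α → ℕ} {h k : α → β} (hf : Primrec f) (hg : Primrec g)
    (hh : Primrec h) (hk : Primrec k) : Primrec fun a => if f a = g a then h a else k a :=
  Primrec.ite (Primrec.eq.comp hf hg) hh hk

@[fun_prop]
theorem primrec_list_range {f : α → ℕ} (hf : Primrec f) : Primrec fun a => List.range (f a) :=
  Primrec.list_range.comp hf

@[fun_prop]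
theorem primrec_list_cons {f : α → β} {g : α → List β} (hf : Primrec f) (hg : Primrec g) :
    Primrec fun a => f a :: g a :=
  Primrec.list_cons.comp hf hg

@[fun_prop]
theorem primrec_list_append {f g : α → List β} (hf : Primrec f) (hg : Primrec g) :
    Primrec fun a => f a ++ g a :=
  Primrec.list_append.comp hf hg

@[fun_prop]
theorem primrec_list_length {f : α → List β} (hf : Primrec f) : Primrec fun a => (f a).length :=
  Primrec.list_length.comp hf

@[fun_prop]
theorem primrec_list_getD {f : α → List β} {g : α → ℕ} {d : β} (hf : Primrec f)
    (hg : Primrec g) : Primrec fun a => (f a).getD (g a) d :=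
  (Primrec.list_getD d).comp hf hg

@[fun_prop]
theorem primrec_list_map {f : α → List β} {g : α → β → σ} (hf : Primrec f)
    (hg : Primrec fun p : α × β => g p.1 p.2) : Primrec fun a => List.map (g a) (f a) :=
  Primrec.list_map hf hg

@[fun_prop]
theorem primrec_list_flatMap {f : α → List β} {g : α → β → List σ} (hf : Primrec f)
    (hg : Primrec fun p : α × β => g p.1 p.2) : Primrec fun a => List.flatMap (g a) (f a) :=
  Primrec.list_flatMap hf hg

@[fun_prop]
theorem primrec_list_sum {f : α → List ℕ} (hf : Primrec f) : Primrec fun a => (f a).sum :=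
  Primrec.list_foldr hf (Primrec.const 0)
    (h := fun _ p => p.1 + p.2) (by unfold Primrec₂; fun_prop)

/-- ℤ is encoded by n ↦ 2n and -(n + 1) ↦ 2n + 1, so the code of a difference of naturals is given
by truncated subtraction and a case distinction. The other operations on ℤ are reduced to this one
through positive and negative parts. -/
theorem primrec_int_subNatNat : Primrec fun p : ℕ × ℕ => Int.subNatNat p.1 p.2 := by
  rw [← Primrec.encode_iff]
  have h : Primrec fun p : ℕ × ℕ => if p.2 - p.1 = 0 then 2 * (p.1 - p.2)
    else 2 * (p.2 - p.1 - 1) + 1 := by fun_prop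
  refine h.of_eq fun p => ?_
  unfold Int.subNatNat
  rcases h : p.2 - p.1 with _ | k
  · rfl
  · rfl

theorem primrec_int_toNat : Primrec Int.toNat := by
  have h : Primrec fun z : ℤ => if Encodable.encode z % 2 = 0 then Encodable.encode z / 2 else 0 :=
    Primrec.ite (Primrec.eq.comp (Primrec.nat_mod.comp Primrec.encode (Primrec.const 2))
      (Primrec.const 0)) (Primrec.nat_div.comp Primrec.encode (Primrec.const 2)) (Primrec.const 0)
  refine h.of_eq fun z => ?_
  rcases z with n | n
  · have : Encodable.encode (Int.ofNat n) = 2 * n := rfl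
    rw [this, if_pos (by omega)]
    simp
  · have : Encodable.encode (Int.negSucc n) = 2 * n + 1 := rfl
    rw [this, if_neg (by omega)]
    rfl

theorem primrec_int_toNat_neg : Primrec fun z : ℤ => (-z).toNat := by
  have h : Primrec fun z : ℤ =>
      if Encodable.encode z % 2 = 0 then 0 else Encodable.encode z / 2 + 1 :=
    Primrec.ite (Primrec.eq.comp (Primrec.nat_mod.comp Primrec.encode (Primrec.const 2))
      (Primrec.const 0)) (Primrec.const 0)
      (Primrec.succ.comp (Primrec.nat_div.comp Primrec.encode (Primrec.const 2)))
  refine h.of_eq fun z => ?_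
  rcases z with n | n
  · have : Encodable.encode (Int.ofNat n) = 2 * n := rfl
    rw [this, if_pos (by omega)]
    simp
  · have : Encodable.encode (Int.negSucc n) = 2 * n + 1 := rfl
    rw [this, if_neg (by omega)]
    simp
    omega

@[fun_prop]
theorem primrec_int_add {f g : α → ℤ} (hf : Primrec f) (hg : Primrec g) :
    Primrec fun a => f a + g a := by
  have h : Primrec₂ fun x y : ℤ =>
      Int.subNatNat (x.toNat + y.toNat) ((-x).toNat + (-y).toNat) :=
    primrec_int_subNatNat.comp <| (primrec_add (primrec_int_toNat.comp Primrec.fst)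
      (primrec_int_toNat.comp Primrec.snd)).pair (primrec_add
      (primrec_int_toNat_neg.comp Primrec.fst) (primrec_int_toNat_neg.comp Primrec.snd))
  refine (h.comp hf hg).of_eq fun a => ?_
  rw [Int.subNatNat_eq_coe]
  omega

@[fun_prop]
theorem primrec_int_natCast {f : α → ℕ} (hf : Primrec f) : Primrec fun a => (f a : ℤ) :=
  (primrec_int_subNatNat.comp (hf.pair (Primrec.const 0))).of_eq fun a => by
    simp [Int.subNatNat_eq_coe]

@[fun_prop]
theorem primrec_int_neg {f : α → ℤ} (hf : Primrec f) : Primrec fun a => -f a :=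
  (primrec_int_subNatNat.comp ((primrec_int_toNat_neg.comp hf).pair
    (primrec_int_toNat.comp hf))).of_eq fun a => by
    rw [Int.subNatNat_eq_coe]
    omega

@[fun_prop]
theorem primrec_list_int_sum {f : α → List ℤ} (hf : Primrec f) : Primrec fun a => (f a).sum :=
  Primrec.list_foldr hf (Primrec.const 0)
    (h := fun _ p => p.1 + p.2) (by unfold Primrec₂; fun_prop)

-- The code of a positive natural number is its predecessor.
@[fun_prop]
theorem primrec_pnat_val {f : α → ℕ+} (hf : Primrec f) : Primrec fun a => (f a : ℕ) :=
  (Primrec.succ.comp (Primrec.encode.comp hf)).of_eq fun a => (f a).natPred_add_one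

/-- Filtering a computable list by a decidable relation is computable. -/
theorem computable_filter {f : α → List β} {p : α → β → Bool} (hf : Computable f)
    (hp : Computable₂ p) : Computable fun a => (f a).filter (p a) := by
  -- As `p` is only computable, the list is traversed by recursion on the number of entries already
  -- inspected. The branch for a missing entry is never taken below the length.
  have h : Computable fun a => Nat.rec (motive := fun _ => List β) []
      (fun i acc => acc ++ Option.casesOn (motive := fun _ => List β) (f a)[i]? []
        fun b => bif p a b then [b] else []) (f a).length := by
    refine Computable.nat_rec (h := fun a q => q.2 ++
      Option.casesOn (motive := fun _ => List β) (f a)[q.1]? []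
        fun b => bif p a b then [b] else [])
      (Computable.list_length.comp hf) (Computable.const []) ?_
    have hc : Computable fun a : α × (ℕ × List β) => (f a.1)[a.2.1]? :=
      Computable.list_getElem?.comp (hf.comp Computable.fst)
        (Computable.fst.comp Computable.snd)
    refine Computable.list_append.comp (Computable.snd.comp Computable.snd)
      (Computable.option_casesOn hc (Computable.const []) ?_)
    exact Computable.cond (hp.comp (Computable.fst.comp Computable.fst) Computable.snd)
      (Computable.list_cons.comp Computable.snd (Computable.const [])) (Computable.const [])
  refine h.of_eq fun a => ?_
  have key : ∀ n ≤ (f a).length, Nat.rec (motive := fun _ => List β) []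
      (fun i acc => acc ++ Option.casesOn (motive := fun _ => List β) (f a)[i]? []
        fun b => bif p a b then [b] else []) n = ((f a).take n).filter (p a) := by
    intro n
    induction n with
    | zero => intro _; simp
    | succ n ih =>
      intro hn
      rw [List.take_succ_eq_append_getElem (by omega), List.filter_append, ← ih (by omega)]
      simp only [List.getElem?_eq_getElem (show n < (f a).length by omega)]
      cases h : p a (f a)[n] <;> simp [h]
  simpa using key _ le_rfl

end Primrec

/-! ### Sparse polynomial systems -/

/-- A polynomial with integer coefficients in the variables `x₀, x₁, …`, as a list of terms, each
a coefficient with the list of the variables to multiply. -/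
abbrev SparsePoly := List (ℤ × List ℕ)

namespace SparsePoly

def eval (x : ℕ → ℚ) (p : SparsePoly) : ℚ := (p.map fun t => (t.1 : ℚ) * (t.2.map x).prod).sum

@[simp]
theorem eval_nil (x : ℕ → ℚ) : eval x [] = 0 := rfl

@[simp]
theorem eval_cons (x : ℕ → ℚ) (t : ℤ × List ℕ) (p : SparsePoly) :
    eval x (t :: p) = (t.1 : ℚ) * (t.2.map x).prod + eval x p := by
  simp [eval]

@[simp]
theorem eval_append (x : ℕ → ℚ) (p p' : SparsePoly) :
    eval x (p ++ p') = eval x p + eval x p' := by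
  simp [eval]

theorem eval_map_range (x : ℕ → ℚ) (n : ℕ) (f : ℕ → ℤ × List ℕ) :
    eval x ((List.range n).map f) =
      ∑ i : Fin n, ((f i).1 : ℚ) * ((f i).2.map x).prod := by
  rw [eval, List.map_map, ← Finset.sum_range fun i => ((f i).1 : ℚ) * ((f i).2.map x).prod]
  rfl

end SparsePoly

/-- The system has a common rational zero. -/
def SparseSolvable (S : List SparsePoly) : Prop := ∃ x : ℕ → ℚ, ∀ p ∈ S, p.eval x = 0

end HBL

namespace HBL

/-! ### Hilbert's Tenth Problem over `ℚ` in terms of sparse systems -/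

theorem PolyCode.eval_toPoly {q : ℕ} (c : PolyCode) (a : Fin q → ℚ) :
    MvPolynomial.eval a (PolyCode.toPoly q c) =
      (c.map fun t => RatCode.toRat t.1 * ∏ i : Fin q, a i ^ t.2.getD i 0).sum := by
  rw [PolyCode.toPoly, map_list_sum, List.map_map]
  congr 1
  refine List.map_congr_left fun t _ => ?_
  simp

/-- The word in the letters `0, …, q - 1` in which `i` occurs `e i` times. -/
def wordOfExponents (q : ℕ) (e : List ℕ) : List ℕ :=
  (List.range q).flatMap fun i => (List.range (e.getD i 0)).map fun _ => i

theorem prod_wordOfExponents (x : ℕ → ℚ) (q : ℕ) (e : List ℕ) :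
    ((wordOfExponents q e).map x).prod = ∏ i : Fin q, x i ^ e.getD i 0 := by
  unfold wordOfExponents
  induction q with
  | zero => simp
  | succ q ih =>
    rw [List.range_succ, List.flatMap_append, List.map_append, List.prod_append, ih,
      Fin.prod_univ_castSucc]
    simp

/-- The sparse form of a coded polynomial in `q` variables; the variable `q + n` stands
for `1 / n`. -/
def PolyCode.toSparse (q : ℕ) (c : PolyCode) : SparsePoly :=
  c.map fun t => (t.1.1, (q + (t.1.2 : ℕ)) :: wordOfExponents q t.2)

/-- A sparse system that is solvable if and only if the coded system is. -/
def sparseOfPolyCodes (s : ℕ × List PolyCode) : List SparsePoly :=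
  s.2.map (fun c => PolyCode.toSparse s.1 c) ++
    s.2.flatMap fun c => c.map fun t => [(((t.1.2 : ℕ) : ℤ), [s.1 + (t.1.2 : ℕ)]), (-1, [])]

theorem primrec_sparseOfPolyCodes : Primrec sparseOfPolyCodes := by
  unfold sparseOfPolyCodes PolyCode.toSparse wordOfExponents
  fun_prop

theorem PolyCode.eval_toSparse {q : ℕ} (c : PolyCode) (x : ℕ → ℚ)
    (hx : ∀ t ∈ c, x (q + (t.1.2 : ℕ)) = 1 / ((t.1.2 : ℕ) : ℚ)) :
    (PolyCode.toSparse q c).eval x =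
      MvPolynomial.eval (fun i : Fin q => x i) (PolyCode.toPoly q c) := by
  rw [PolyCode.eval_toPoly, SparsePoly.eval, PolyCode.toSparse, List.map_map]
  congr 1
  refine List.map_congr_left fun t ht => ?_
  simp only [Function.comp_apply, List.map_cons, List.prod_cons, hx t ht, prod_wordOfExponents,
    RatCode.toRat]
  ring

/-- For every denominator n that occurs, the equation n · x_(q+n) - 1 = 0 makes x_(q+n) the inverse
of n. These variables do not clash with the original ones, whose numbers are less than q. -/
theorem sparseSolvable_sparseOfPolyCodes (s : ℕ × List PolyCode) :
    SparseSolvable (sparseOfPolyCodes s) ↔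
      (rationalZeros {f | ∃ c ∈ s.2, f = PolyCode.toPoly s.1 c}).Nonempty := by
  constructor
  · rintro ⟨x, hx⟩
    have hinv : ∀ c ∈ s.2, ∀ t ∈ c, x (s.1 + (t.1.2 : ℕ)) = 1 / ((t.1.2 : ℕ) : ℚ) := by
      intro c hc t ht
      have := hx _ (List.mem_append_right _ (List.mem_flatMap.2 ⟨c, hc, List.mem_map.2 ⟨t, ht, rfl⟩⟩))
      have h0 : ((t.1.2 : ℕ) : ℚ) ≠ 0 := by exact_mod_cast t.1.2.ne_zero
      rw [eq_div_iff h0]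
      simp only [SparsePoly.eval_cons, SparsePoly.eval_nil, List.map_cons, List.map_nil,
        List.prod_cons, List.prod_nil] at this
      push_cast at this
      linarith
    refine ⟨fun i => x i, ?_⟩
    rintro _ ⟨c, hc, rfl⟩
    rw [← PolyCode.eval_toSparse c x (hinv c hc)]
    exact hx _ (List.mem_append_left _ (List.mem_map.2 ⟨c, hc, rfl⟩))
  · rintro ⟨a, ha⟩
    -- All inverses are supplied at once. The value 1 / 0 = 0 of the variable q is irrelevant, as
    -- denominators are positive.
    let x : ℕ → ℚ := fun n => if h : n < s.1 then a ⟨n, h⟩ else 1 / ((n - s.1 : ℕ) : ℚ)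
    have hx : ∀ n, x (s.1 + n) = 1 / (n : ℚ) := fun n => by simp [x]
    have hxa : (fun i : Fin s.1 => x i) = a := by
      funext i
      simp [x]
    refine ⟨x, fun p hp => ?_⟩
    rcases List.mem_append.1 hp with hp | hp
    · obtain ⟨c, hc, rfl⟩ := List.mem_map.1 hp
      rw [PolyCode.eval_toSparse c x fun t _ => hx _, hxa]
      exact ha _ ⟨c, hc, rfl⟩
    · obtain ⟨c, hc, hp⟩ := List.mem_flatMap.1 hp
      obtain ⟨t, ht, rfl⟩ := List.mem_map.1 hp
      have h0 : ((t.1.2 : ℕ) : ℚ) ≠ 0 := by exact_mod_cast t.1.2.ne_zero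
      simp [hx, h0]

/-- A strict upper bound for the variables of a sparse system. -/
def variableBound (S : List SparsePoly) : ℕ :=
  (S.map fun p => (p.map fun t => t.2.sum).sum).sum + 1

theorem lt_variableBound {S : List SparsePoly} {p : SparsePoly} (hp : p ∈ S) {t : ℤ × List ℕ}
    (ht : t ∈ p) {i : ℕ} (hi : i ∈ t.2) : i < variableBound S := by
  have h1 : i ≤ t.2.sum := List.le_sum_of_mem hi
  have h2 : t.2.sum ≤ (p.map fun t => t.2.sum).sum :=
    List.le_sum_of_mem (List.mem_map.2 ⟨t, ht, rfl⟩)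
  have h3 : (p.map fun t => t.2.sum).sum ≤ (S.map fun p => (p.map fun t => t.2.sum).sum).sum :=
    List.le_sum_of_mem (List.mem_map.2 ⟨p, hp, rfl⟩)
  unfold variableBound
  omega

/-- The code, as a polynomial in `q` variables, of a sparse polynomial. -/
def SparsePoly.toPolyCode (q : ℕ) (p : SparsePoly) : PolyCode :=
  p.map fun t => ((t.1, 1), (List.range q).map fun i =>
    (t.2.map fun a => if a = i then 1 else 0).sum)

def polyCodesOfSparse (S : List SparsePoly) : ℕ × List PolyCode :=
  (variableBound S, S.map fun p => p.toPolyCode (variableBound S))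

theorem primrec_polyCodesOfSparse : Primrec polyCodesOfSparse := by
  unfold polyCodesOfSparse SparsePoly.toPolyCode variableBound
  fun_prop

/-- Each letter of the word contributes to exactly one factor on the left, because all letters are
less than `q`. -/
theorem prod_pow_count {q : ℕ} (a : Fin q → ℚ) (x : ℕ → ℚ) (hx : ∀ i : Fin q, x i = a i)
    (w : List ℕ) (hw : ∀ i ∈ w, i < q) :
    ∏ i : Fin q, a i ^ (w.map fun b => if b = (i : ℕ) then 1 else 0).sum = (w.map x).prod := by
  induction w with
  | nil => simp
  | cons b w ih =>
    simp only [List.map_cons, List.sum_cons, List.prod_cons, pow_add, Finset.prod_mul_distrib]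
    rw [ih fun i hi => hw i (List.mem_cons_of_mem _ hi)]
    congr 1
    have hb : b < q := hw b List.mem_cons_self
    rw [Finset.prod_eq_single ⟨b, hb⟩]
    · simp [← hx]
    · intro i _ hi
      rw [if_neg fun h => hi (Fin.ext h.symm), pow_zero]
    · simp

theorem SparsePoly.eval_toPolyCode {q : ℕ} (p : SparsePoly) (a : Fin q → ℚ) (x : ℕ → ℚ)
    (hx : ∀ i : Fin q, x i = a i) (hp : ∀ t ∈ p, ∀ i ∈ t.2, i < q) :
    MvPolynomial.eval a (PolyCode.toPoly q (p.toPolyCode q)) = p.eval x := by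
  rw [PolyCode.eval_toPoly, SparsePoly.eval, SparsePoly.toPolyCode, List.map_map]
  congr 1
  refine List.map_congr_left fun t ht => ?_
  rw [← prod_pow_count a x hx t.2 (hp t ht)]
  simp [RatCode.toRat]

theorem nonempty_rationalZeros_polyCodesOfSparse (S : List SparsePoly) :
    (rationalZeros {f | ∃ c ∈ (polyCodesOfSparse S).2,
      f = PolyCode.toPoly (polyCodesOfSparse S).1 c}).Nonempty ↔ SparseSolvable S := by
  constructor
  · rintro ⟨a, ha⟩
    let x : ℕ → ℚ := fun n => if h : n < variableBound S then a ⟨n, h⟩ else 0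
    refine ⟨x, fun p hp => ?_⟩
    rw [← p.eval_toPolyCode a x (fun i => dif_pos i.2)
      fun t ht i hi => lt_variableBound hp ht hi]
    exact ha _ ⟨_, List.mem_map.2 ⟨p, hp, rfl⟩, rfl⟩
  · rintro ⟨x, hx⟩
    refine ⟨fun i => x i, ?_⟩
    rintro _ ⟨_, hc, rfl⟩
    obtain ⟨p, hp, rfl⟩ := List.mem_map.1 hc
    exact (p.eval_toPolyCode _ x (fun i => rfl)
      fun t ht i hi => lt_variableBound hp ht hi).trans (hx p hp)

theorem hilbertTenthRatDecidable_iff_sparse :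
    HilbertTenthRatDecidable ↔ ComputablePred SparseSolvable := by
  constructor
  · intro h
    obtain ⟨f, hf, hfp⟩ := ComputablePred.computable_iff.1 h
    refine ComputablePred.computable_iff.2
      ⟨fun S => f (polyCodesOfSparse S), hf.comp primrec_polyCodesOfSparse.to_comp, ?_⟩
    funext S
    rw [← nonempty_rationalZeros_polyCodesOfSparse]
    exact congrFun hfp (polyCodesOfSparse S)
  · intro h
    obtain ⟨f, hf, hfp⟩ := ComputablePred.computable_iff.1 h
    refine ComputablePred.computable_iff.2
      ⟨fun s => f (sparseOfPolyCodes s), hf.comp primrec_sparseOfPolyCodes.to_comp, ?_⟩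
    funext s
    rw [← sparseSolvable_sparseOfPolyCodes]
    exact congrFun hfp (sparseOfPolyCodes s)

end HBL

namespace HBL

open Module

/-! ### Subgroups whose images have rank zero, one or two -/

section Rank

variable {A T ι : Type*} [AddCommGroup A] [AddCommGroup T]

/-- The image of `H` under the functionals `g i` consists of pairwise proportional vectors, not all
of which vanish. -/
def RankOneOn (H : AddSubgroup A) (g : ι → A →+ ℤ) : Prop :=
  (∃ h ∈ H, ∃ i, g i h ≠ 0) ∧ ∀ h ∈ H, ∀ h' ∈ H, ∀ i j, g i h * g j h' = g j h * g i h'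

variable [Module.Finite ℤ A]

theorem finite_addSubgroup_map (H : AddSubgroup A) (f : A →+ T) : Module.Finite ℤ (H.map f) := by
  have h1 : Module.Finite ℤ (AddSubgroup.toIntSubmodule H) := inferInstance
  have h2 : Module.Finite ℤ ((AddSubgroup.toIntSubmodule H).map f.toIntLinearMap) := inferInstance
  exact h2

-- `f` enters only through its kernel, which is the common kernel of integer-valued functionals. In
-- particular `f` has torsion-free image, although `T` may have torsion.
variable {f : A →+ T} {g : ι → A →+ ℤ} (hfg : ∀ a, f a = 0 ↔ ∀ i, g i a = 0)
include hfg

theorem finrank_map_eq_zero_iff (H : AddSubgroup A) :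
    finrank ℤ (H.map f) = 0 ↔ ∀ h ∈ H, ∀ i, g i h = 0 := by
  have := finite_addSubgroup_map H f
  rw [finrank_eq_zero_iff]
  constructor
  · intro hx h hh i
    obtain ⟨a, ha, h0⟩ := hx ⟨f h, AddSubgroup.mem_map_of_mem f hh⟩
    have h1 : f (a • h) = 0 := by
      rw [map_zsmul]
      exact congrArg Subtype.val h0
    have h2 := (hfg _).1 h1 i
    rw [map_zsmul, smul_eq_mul] at h2
    exact (mul_eq_zero.1 h2).resolve_left ha
  · rintro hx ⟨_, h, hh, rfl⟩
    refine ⟨1, one_ne_zero, ?_⟩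
    rw [one_smul]
    exact Subtype.ext ((hfg h).2 (hx h hh))

/-- Two elements of an image of rank one satisfy a non-trivial relation, which carries over to each
functional and makes the 2 × 2 minors vanish. Conversely, vanishing minors say that g_i(h') f(h) -
g_i(h) f(h') = 0, so two elements of the image are never independent. -/
theorem finrank_map_eq_one_iff (H : AddSubgroup A) :
    finrank ℤ (H.map f) = 1 ↔ RankOneOn H g := by
  have := finite_addSubgroup_map H f
  have hzero : finrank ℤ (H.map f) ≠ 0 ↔ ∃ h ∈ H, ∃ i, g i h ≠ 0 := by
    rw [Ne, finrank_map_eq_zero_iff hfg]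
    push Not
    rfl
  constructor
  · intro h1
    refine ⟨hzero.1 (by omega), fun h hh h' hh' i j => ?_⟩
    have hdep : ¬ LinearIndependent ℤ
        (![⟨f h, AddSubgroup.mem_map_of_mem f hh⟩, ⟨f h', AddSubgroup.mem_map_of_mem f hh'⟩] :
          Fin 2 → H.map f) := by
      intro hli
      have := hli.fintype_card_le_finrank
      rw [h1] at this
      simp at this
    rw [LinearIndependent.pair_iff] at hdep
    push Not at hdep
    obtain ⟨s, t, hst, hne⟩ := hdep
    have hst' : f (s • h + t • h') = 0 := by
      rw [map_add, map_zsmul, map_zsmul]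
      exact congrArg Subtype.val hst
    have key : ∀ k, s * g k h + t * g k h' = 0 := fun k => by
      simpa using (hfg _).1 hst' k
    -- Eliminating between the relations for `i` and `j` gives the minor times `t`, or times `s`;
    -- one of the two coefficients can be cancelled.
    by_cases hs : s = 0
    · have ht := hne hs
      apply mul_left_cancel₀ ht
      linear_combination g i h * key j - g j h * key i
    · apply mul_left_cancel₀ hs
      linear_combination g j h' * key i - g i h' * key j
  · rintro ⟨hne, hmin⟩
    have h0 := hzero.2 hne
    by_contra h1
    obtain ⟨w, hw⟩ := exists_linearIndependent_of_le_finrank (R := ℤ) (M := H.map f) (n := 2)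
      (by omega)
    obtain ⟨h, hh, hwh⟩ := (w 0).2
    obtain ⟨h', hh', hwh'⟩ := (w 1).2
    have hw2 : LinearIndependent ℤ ![w 0, w 1] := by
      convert hw using 1
      funext i
      fin_cases i <;> rfl
    rw [LinearIndependent.pair_iff] at hw2
    -- Independence kills the coefficients of the relation coming from the minors. Hence all
    -- functionals vanish on `h`, so f(h) = 0, which contradicts its being part of an independent
    -- pair.
    have hgh : ∀ i, g i h = 0 := by
      intro i
      have hcomb : g i h' • h + (-g i h) • h' ∈ H :=
        H.add_mem (H.zsmul_mem hh _) (H.zsmul_mem hh' _)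
      have hz : f (g i h' • h + (-g i h) • h') = 0 := by
        refine (hfg _).2 fun j => ?_
        simp only [map_add, map_zsmul, smul_eq_mul]
        linear_combination -hmin h hh h' hh' i j
      have := (hw2 (g i h') (-g i h) (Subtype.ext (by
        rw [map_add, map_zsmul, map_zsmul] at hz
        change g i h' • (w 0).1 + (-g i h) • (w 1).1 = 0
        rw [← hwh, ← hwh', hz]))).2
      omega
    have := (hw2 1 0 (Subtype.ext (by
      change (1 : ℤ) • (w 0).1 + (0 : ℤ) • (w 1).1 = 0
      rw [← hwh, (hfg h).2 hgh]
      simp))).1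
    omega

end Rank

/-! ### Subgroups of rank two that encode a solution of a quadratic system -/

section Encoding

variable {A ι κ μ : Type*} [AddCommGroup A] [Fintype ι]

/-- Conditions on a subgroup, in terms of coordinates `(u, v)` on `A`, that force it to be of finite
index in `{(αx, βx)}` for a vector `x` with `x o = 1`, `x (i₁ m) * x (i₂ m) = x (i₃ m)` and on which
the linear forms vanish whose pullbacks by `u` are `l`. -/
structure EncodesSolution (o : ι) (u v : ι → A →+ ℤ) (i₁ i₂ i₃ : μ → ι) (l : κ → A →+ ℤ)
    (H : AddSubgroup A) : Prop where
  rank : finrank ℤ H = 2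
  u_o : RankOneOn H fun _ : Unit => u o
  v_o : RankOneOn H fun _ : Unit => v o
  u_all : RankOneOn H u
  v_all : RankOneOn H v
  eq : ∀ j, j ≠ o → RankOneOn H ![u o - v o, u j - v j]
  mul : ∀ m, RankOneOn H ![u (i₁ m) + v o, u (i₃ m) + v (i₂ m)]
  lin : ∀ k, ∀ h ∈ H, l k h = 0

variable {o : ι} {u v : ι → A →+ ℤ} {i₁ i₂ i₃ : μ → ι} {c : κ → ι → ℤ} {l : κ → A →+ ℤ}

/-- The pair (f, g) embeds `H` in ℤ², so two independent elements have images with non-zero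
determinant. -/
theorem exists_mul_ne_of_finrank_eq_two {H : AddSubgroup A} (hH : finrank ℤ H = 2)
    (f g : A →+ ℤ) (hinj : ∀ h ∈ H, f h = 0 → g h = 0 → h = 0) :
    ∃ h ∈ H, ∃ h' ∈ H, f h * g h' - f h' * g h ≠ 0 := by
  by_contra! hdet
  obtain ⟨w, hw⟩ := exists_linearIndependent_of_le_finrank (R := ℤ) (M := H) (n := 2) hH.ge
  have hw2 : LinearIndependent ℤ ![w 0, w 1] := by
    convert hw using 1
    funext i
    fin_cases i <;> rfl
  rw [LinearIndependent.pair_iff] at hw2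
  have hd := hdet _ (w 0).2 _ (w 1).2
  have key : ∀ s t : ℤ, s * f (w 0) + t * f (w 1) = 0 → s * g (w 0) + t * g (w 1) = 0 →
      s = 0 ∧ t = 0 := by
    intro s t h1 h2
    refine hw2 s t (Subtype.ext (hinj _ (s • w 0 + t • w 1).2 ?_ ?_))
    · simpa using h1
    · simpa using h2
  -- If the determinant vanishes, then g(w₁)w₀ - g(w₀)w₁ and f(w₁)w₀ - f(w₀)w₁ are killed by both
  -- functionals. So `f` and `g` vanish on both elements, and then even the relation 1 · w₀ = 0
  -- would hold.
  have h1 := key (g (w 1)) (-g (w 0)) (by linear_combination hd) (by ring)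
  have h2 := key (f (w 1)) (-f (w 0)) (by ring) (by linear_combination -hd)
  have := key 1 0 (by linarith) (by linarith)
  omega

/-- On `H` the coordinates are u = u_o x and v = v_o y. Injectivity of (u, v) then makes (u_o, v_o)
injective on `H`, so a non-zero determinant Δ is available for cancellation. -/
theorem EncodesSolution.exists_solution
    (hinj : ∀ a, (∀ i, u i a = 0) → (∀ i, v i a = 0) → a = 0)
    (hl : ∀ k a, l k a = ∑ i, c k i * u i a) {H : AddSubgroup A}
    (hH : EncodesSolution o u v i₁ i₂ i₃ l H) :
    ∃ x : ι → ℚ, x o = 1 ∧ (∀ m, x (i₁ m) * x (i₂ m) = x (i₃ m)) ∧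
      ∀ k, ∑ i, (c k i : ℚ) * x i = 0 := by
  obtain ⟨h₀, hh₀, _, hu₀⟩ := hH.u_o.1
  obtain ⟨h₁, hh₁, _, hv₁⟩ := hH.v_o.1
  have hu₀' : (u o h₀ : ℚ) ≠ 0 := by exact_mod_cast hu₀
  have hv₁' : (v o h₁ : ℚ) ≠ 0 := by exact_mod_cast hv₁
  let x : ι → ℚ := fun i => u i h₀ / u o h₀
  let y : ι → ℚ := fun i => v i h₁ / v o h₁
  have hx : ∀ h ∈ H, ∀ i, (u i h : ℚ) = u o h * x i := by
    intro h hh i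
    have := hH.u_all.2 h hh h₀ hh₀ i o
    simp only [x]
    rw [mul_div_assoc', eq_div_iff hu₀']
    exact_mod_cast this
  have hy : ∀ h ∈ H, ∀ i, (v i h : ℚ) = v o h * y i := by
    intro h hh i
    have := hH.v_all.2 h hh h₁ hh₁ i o
    simp only [y]
    rw [mul_div_assoc', eq_div_iff hv₁']
    exact_mod_cast this
  obtain ⟨e, he, e', he', hdet⟩ := exists_mul_ne_of_finrank_eq_two hH.rank (u o) (v o) (by
    intro h hh hu hv
    refine hinj h (fun i => ?_) fun i => ?_
    · have := hx h hh i
      rw [hu, Int.cast_zero, zero_mul] at this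
      exact_mod_cast this
    · have := hy h hh i
      rw [hv, Int.cast_zero, zero_mul] at this
      exact_mod_cast this)
  have hdet' : (u o e : ℚ) * v o e' - u o e' * v o e ≠ 0 := by exact_mod_cast hdet
  have hxo : x o = 1 := div_self hu₀'
  have hyx : ∀ j, y j = x j := by
    intro j
    by_cases hj : j = o
    · rw [hj, hxo]
      exact div_self hv₁'
    have h2 := (hH.eq j hj).2 e he e' he' 0 1
    simp only [Matrix.cons_val_zero, Matrix.cons_val_one, AddMonoidHom.sub_apply] at h2
    have h3 : ((u o e : ℚ) - v o e) * (u j e' - v j e') =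
      (u j e - v j e) * (u o e' - v o e') := by exact_mod_cast h2
    rw [hx e he j, hx e' he' j, hy e he j, hy e' he' j] at h3
    apply mul_left_cancel₀ hdet'
    -- The minor of (u_o - v_o, u_j - v_j) is Δ (x_j - y_j).
    linear_combination -h3
  refine ⟨x, hxo, fun m => ?_, fun k => ?_⟩
  · have h2 := (hH.mul m).2 e he e' he' 0 1
    simp only [Matrix.cons_val_zero, Matrix.cons_val_one, AddMonoidHom.add_apply] at h2
    have h3 : ((u (i₁ m) e : ℚ) + v o e) * (u (i₃ m) e' + v (i₂ m) e') =
      (u (i₃ m) e + v (i₂ m) e) * (u (i₁ m) e' + v o e') := by exact_mod_cast h2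
    rw [hx e he (i₁ m), hx e' he' (i₁ m), hx e he (i₃ m), hx e' he' (i₃ m), hy e he (i₂ m),
      hy e' he' (i₂ m), hyx] at h3
    apply mul_left_cancel₀ hdet'
    -- With y = x, the minor of (u_(i₁) + v_o, u_(i₃) + v_(i₂)) is Δ (x_(i₁) x_(i₂) - x_(i₃)).
    linear_combination h3
  · have h2 := hH.lin k h₀ hh₀
    rw [hl] at h2
    have h3 : ∑ i, (c k i : ℚ) * u i h₀ = 0 := by exact_mod_cast h2
    simp only [x, mul_div_assoc']
    rw [← Finset.sum_div, h3, zero_div]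

/-- The subgroup is spanned by the points with coordinates (X, 0) and (0, X), where X = Dx is
integral and X_o = D ≠ 0. -/
theorem exists_encodesSolution
    (hsurj : ∀ U V : ι → ℤ, ∃ a, (∀ i, u i a = U i) ∧ ∀ i, v i a = V i)
    (hl : ∀ k a, l k a = ∑ i, c k i * u i a) {x : ι → ℚ} (hxo : x o = 1)
    (hmul : ∀ m, x (i₁ m) * x (i₂ m) = x (i₃ m)) (hlin : ∀ k, ∑ i, (c k i : ℚ) * x i = 0) :
    ∃ H : AddSubgroup A, EncodesSolution o u v i₁ i₂ i₃ l H := by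
  obtain ⟨⟨D, hD⟩, hDx⟩ := IsLocalization.exist_integer_multiples_of_finite (nonZeroDivisors ℤ) x
  have hD0 : D ≠ 0 := nonZeroDivisors.ne_zero hD
  choose X hX using hDx
  have hX' : ∀ i, (X i : ℚ) = D * x i := fun i => by
    simpa using hX i
  have hD0' : (D : ℚ) ≠ 0 := by exact_mod_cast hD0
  have hXo : X o ≠ 0 := by
    have : (X o : ℚ) ≠ 0 := by
      rw [hX', hxo, mul_one]
      exact hD0'
    exact_mod_cast this
  -- Clearing denominators homogenizes the product equations, with X_o as the extra variable.
  have hXmul : ∀ m, X (i₁ m) * X (i₂ m) = X o * X (i₃ m) := fun m => by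
    have : (X (i₁ m) : ℚ) * X (i₂ m) = X o * X (i₃ m) := by
      rw [hX', hX', hX', hX', hxo, ← hmul m]
      ring
    exact_mod_cast this
  have hXlin : ∀ k, ∑ i, c k i * X i = 0 := fun k => by
    have : ∑ i, (c k i : ℚ) * X i = 0 := by
      simp only [hX', mul_left_comm _ (D : ℚ)]
      rw [← Finset.mul_sum, hlin, mul_zero]
    exact_mod_cast this
  obtain ⟨e, hue, hve⟩ := hsurj X 0
  obtain ⟨e', hue', hve'⟩ := hsurj 0 X
  let L : (ℤ × ℤ) →ₗ[ℤ] A :=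
    (LinearMap.toSpanSingleton ℤ A e).coprod (LinearMap.toSpanSingleton ℤ A e')
  have hL : ∀ p, L p = p.1 • e + p.2 • e' := fun p => rfl
  have hu : ∀ p i, u i (L p) = p.1 * X i := fun p i => by simp [hL, hue, hue']
  have hv : ∀ p i, v i (L p) = p.2 * X i := fun p i => by simp [hL, hve, hve']
  have hLinj : Function.Injective L := by
    rw [← LinearMap.ker_eq_bot, LinearMap.ker_eq_bot']
    intro p hp
    have h1 := hu p o
    have h2 := hv p o
    rw [hp, map_zero, eq_comm, mul_eq_zero, or_iff_left hXo] at h1 h2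
    exact Prod.ext h1 h2
  refine ⟨(LinearMap.range L).toAddSubgroup, ?_, ?_, ?_, ?_, ?_, ?_, ?_, ?_⟩
  · change finrank ℤ (LinearMap.range L) = 2
    rw [LinearMap.finrank_range_of_inj hLinj]
    simp
  · refine ⟨⟨_, ⟨(1, 0), rfl⟩, (), by simpa [hu] using hXo⟩, ?_⟩
    rintro _ ⟨p, rfl⟩ _ ⟨p', rfl⟩ i j
    ring
  · refine ⟨⟨_, ⟨(0, 1), rfl⟩, (), by simpa [hv] using hXo⟩, ?_⟩
    rintro _ ⟨p, rfl⟩ _ ⟨p', rfl⟩ i j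
    ring
  · refine ⟨⟨_, ⟨(1, 0), rfl⟩, o, by simpa [hu] using hXo⟩, ?_⟩
    rintro _ ⟨p, rfl⟩ _ ⟨p', rfl⟩ i j
    simp only [hu]
    ring
  · refine ⟨⟨_, ⟨(0, 1), rfl⟩, o, by simpa [hv] using hXo⟩, ?_⟩
    rintro _ ⟨p, rfl⟩ _ ⟨p', rfl⟩ i j
    simp only [hv]
    ring
  · intro j _
    refine ⟨⟨_, ⟨(1, 0), rfl⟩, 0, by simpa [hu, hv] using hXo⟩, ?_⟩
    rintro _ ⟨p, rfl⟩ _ ⟨p', rfl⟩ i i'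
    fin_cases i <;> fin_cases i' <;> simp [hu, hv] <;> ring
  · intro m
    -- At (0, 1) the first functional takes the value X_o ≠ 0; at (1, 0) both functionals could
    -- vanish.
    refine ⟨⟨_, ⟨(0, 1), rfl⟩, 0, by simpa [hu, hv] using hXo⟩, ?_⟩
    rintro _ ⟨p, rfl⟩ _ ⟨p', rfl⟩ i i'
    fin_cases i <;> fin_cases i' <;> simp [hu, hv] <;> try ring1
    · linear_combination (p'.2 * p.1 - p.2 * p'.1) * hXmul m
    · linear_combination (p.2 * p'.1 - p'.2 * p.1) * hXmul m
  · rintro k _ ⟨p, rfl⟩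
    rw [hl]
    simp only [hu, mul_left_comm _ p.1]
    rw [← Finset.mul_sum, hXlin, mul_zero]

end Encoding

end HBL

namespace HBL

open Module

/-! ### The integer matrices of a basic system -/

/-- The functional `w ↦ x ⬝ᵥ w`. -/
def dotHom {n : Type*} [Fintype n] (x : n → ℤ) : (n → ℤ) →+ ℤ where
  toFun w := x ⬝ᵥ w
  map_zero' := dotProduct_zero x
  map_add' := dotProduct_add x

@[simp]
theorem dotHom_apply {n : Type*} [Fintype n] (x w : n → ℤ) : dotHom x w = x ⬝ᵥ w := rfl

section Matrices

variable {q : ℕ}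

theorem dotHom_rowU (i : Fin (q + 1)) (w : Coord q → ℤ) : dotHom (rowU i) w = w (Sum.inl i) := by
  simp [rowU]

theorem dotHom_rowV (i : Fin (q + 1)) (w : Coord q → ℤ) : dotHom (rowV i) w = w (Sum.inr i) := by
  simp [rowV]

theorem dotHom_add {n : Type*} [Fintype n] (x y : n → ℤ) : dotHom (x + y) = dotHom x + dotHom y := by
  ext w
  simp

theorem dotHom_sub {n : Type*} [Fintype n] (x y : n → ℤ) : dotHom (x - y) = dotHom x - dotHom y := by
  ext w
  simp

theorem mulVec_eq_zero_iff {n : Type*} [Fintype n] (M : Matrix n n ℤ) (w : n → ℤ) :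
    M.mulVecLin.toAddMonoidHom w = 0 ↔ ∀ r, dotHom (M r) w = 0 :=
  funext_iff

theorem oneRow_apply (x : Coord q → ℤ) (r : Coord q) :
    oneRow x r = if r = Sum.inl 0 then x else 0 := rfl

theorem twoRows_apply (x y : Coord q → ℤ) (r : Coord q) :
    twoRows x y r = if r = Sum.inl 0 then x else if r = Sum.inl 1 then y else 0 := rfl

theorem oneRow_eq_zero_iff (x w : Coord q → ℤ) :
    (oneRow x).mulVecLin.toAddMonoidHom w = 0 ↔ ∀ _ : Unit, dotHom x w = 0 := by
  simp only [mulVec_eq_zero_iff, forall_const, oneRow_apply]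
  constructor
  · intro h
    simpa using h (Sum.inl 0)
  · intro h r
    by_cases hr : r = Sum.inl 0
    · simpa [hr] using h
    · simp [hr]

/-- For q = 0 the row indices 0 and 1 coincide and the second row is lost. -/
theorem twoRows_eq_zero_iff (hq : q ≠ 0) (x y w : Coord q → ℤ) :
    (twoRows x y).mulVecLin.toAddMonoidHom w = 0 ↔ ∀ i, ![dotHom x, dotHom y] i w = 0 := by
  obtain ⟨q, rfl⟩ := Nat.exists_eq_succ_of_ne_zero hq
  simp only [mulVec_eq_zero_iff, Fin.forall_fin_two, twoRows_apply]
  constructor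
  · intro h
    have h0 := h (Sum.inl 0)
    have h1 := h (Sum.inl 1)
    simp only [if_true, Sum.inl.injEq, one_ne_zero, if_false] at h0 h1
    exact ⟨h0, h1⟩
  · rintro ⟨h0, h1⟩ r
    by_cases hr : r = Sum.inl 0
    · simpa [hr] using h0
    · by_cases hr' : r = Sum.inl 1
      · simpa [hr'] using h1
      · simp [hr, hr']

theorem blockU_eq_zero_iff (w : Coord q → ℤ) :
    (Matrix.of (Sum.elim (fun i => rowU i) fun _ => 0) :
      Matrix (Coord q) (Coord q) ℤ).mulVecLin.toAddMonoidHom w = 0 ↔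
      ∀ i, dotHom (rowU i : Coord q → ℤ) w = 0 := by
  rw [mulVec_eq_zero_iff, Sum.forall]
  exact and_iff_left fun _ => zero_dotProduct w

theorem blockV_eq_zero_iff (w : Coord q → ℤ) :
    (Matrix.of (Sum.elim (fun i => rowV i) fun _ => 0) :
      Matrix (Coord q) (Coord q) ℤ).mulVecLin.toAddMonoidHom w = 0 ↔
      ∀ i, dotHom (rowV i : Coord q → ℤ) w = 0 := by
  rw [mulVec_eq_zero_iff, Sum.forall]
  exact and_iff_left fun _ => zero_dotProduct w

variable {t s k l : ℕ} (S : BasicSystem (t + s) k l) (a : Fin t → RatCode)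

/-- The linear forms in `(u₀, …, u_q)` for the parameters and the affine polynomials. -/
def BasicSystem.linearForms : Fin t ⊕ Fin l → Fin (t + s + 1) → ℤ
  | .inl j => (a j).1 • Pi.single 0 1 - ((a j).2 : ℤ) • Pi.single (Fin.castAdd s j).succ 1
  | .inr j => S.intCoeff j

/-- The functionals for the parameters and the affine polynomials. -/
def BasicSystem.linearHoms : Fin t ⊕ Fin l → (Coord (t + s) → ℤ) →+ ℤ
  | .inl j => dotHom ((a j).1 • rowU 0 - ((a j).2 : ℤ) • rowU (Fin.castAdd s j).succ)
  | .inr j => dotHom (∑ i, S.intCoeff j i • rowU i)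

theorem BasicSystem.linearHoms_apply (r : Fin t ⊕ Fin l) (w : Coord (t + s) → ℤ) :
    S.linearHoms a r w = ∑ i, S.linearForms a r i * dotHom (rowU i) w := by
  rcases r with j | j
  · simp only [linearHoms, linearForms, dotHom_sub, AddMonoidHom.sub_apply, Pi.sub_apply,
      Pi.smul_apply, sub_mul, Finset.sum_sub_distrib, dotHom_apply, smul_dotProduct, smul_eq_mul,
      mul_assoc, ← Finset.mul_sum]
    simp [Pi.single_apply]
  · simp only [linearHoms, linearForms, dotHom_apply, sum_dotProduct, smul_dotProduct, smul_eq_mul]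

theorem BasicSystem.mem_matrixRealizers_iff :
    S.matrices a ∈ matrixRealizers 2 MatrixIndex.rank ↔
      ∃ H, EncodesSolution 0 (fun i => dotHom (rowU i)) (fun i => dotHom (rowV i))
        (fun m => (S.i₁ m).succ) (fun m => (S.i₂ m).succ) (fun m => (S.i₃ m).succ)
        (S.linearHoms a) H := by
  refine exists_congr fun H => ⟨?_, ?_⟩
  · rintro ⟨hr, hi⟩
    refine ⟨hr, ?_, ?_, ?_, ?_, ?_, ?_, ?_⟩
    · exact (finrank_map_eq_one_iff (oneRow_eq_zero_iff _) H).1 (hi .u₀)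
    · exact (finrank_map_eq_one_iff (oneRow_eq_zero_iff _) H).1 (hi .v₀)
    · exact (finrank_map_eq_one_iff blockU_eq_zero_iff H).1 (hi .u)
    · exact (finrank_map_eq_one_iff blockV_eq_zero_iff H).1 (hi .v)
    · intro j hj
      obtain ⟨j, rfl⟩ := Fin.exists_succ_eq.2 hj
      -- The number of variables is not zero because `j` is one of them.
      have := (finrank_map_eq_one_iff (twoRows_eq_zero_iff (fun h => (h ▸ j).elim0) _ _) H).1
        (hi (.eq j))
      simpa only [dotHom_sub] using this
    · intro m
      have := (finrank_map_eq_one_iff (twoRows_eq_zero_iff (fun h => (h ▸ S.i₁ m).elim0) _ _) H).1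
        (hi (.mul m))
      simpa only [dotHom_add] using this
    · rintro (j | j) h hh
      · exact (finrank_map_eq_zero_iff (oneRow_eq_zero_iff _) H).1 (hi (.param j)) h hh ()
      · exact (finrank_map_eq_zero_iff (oneRow_eq_zero_iff _) H).1 (hi (.affine j)) h hh ()
  · intro hH
    refine ⟨hH.rank, ?_⟩
    rintro (_ | _ | _ | _ | j | j | j | j)
    · exact (finrank_map_eq_one_iff (oneRow_eq_zero_iff _) H).2 hH.u_o
    · exact (finrank_map_eq_one_iff (oneRow_eq_zero_iff _) H).2 hH.v_o
    · exact (finrank_map_eq_one_iff blockU_eq_zero_iff H).2 hH.u_all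
    · exact (finrank_map_eq_one_iff blockV_eq_zero_iff H).2 hH.v_all
    · refine (finrank_map_eq_one_iff (twoRows_eq_zero_iff (fun h => (h ▸ j).elim0) _ _) H).2 ?_
      simpa only [dotHom_sub] using hH.eq j.succ (Fin.succ_ne_zero j)
    · refine (finrank_map_eq_one_iff (twoRows_eq_zero_iff (fun h => (h ▸ S.i₁ j).elim0) _ _) H).2 ?_
      simpa only [dotHom_add] using hH.mul j
    · exact (finrank_map_eq_zero_iff (oneRow_eq_zero_iff _) H).2 fun h hh _ => hH.lin (.inl j) h hh
    · exact (finrank_map_eq_zero_iff (oneRow_eq_zero_iff _) H).2 fun h hh _ => hH.lin (.inr j) h hh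

theorem BasicSystem.linearForms_inl_eq_zero_iff (j : Fin t) (x : Fin (t + s + 1) → ℚ)
    (hx : x 0 = 1) :
    ∑ i, (S.linearForms a (.inl j) i : ℚ) * x i = 0 ↔
      x (Fin.castAdd s j).succ = (a j).toRat := by
  have h0 : (((a j).2 : ℕ) : ℚ) ≠ 0 := by exact_mod_cast (a j).2.ne_zero
  have : ∑ i, (S.linearForms a (.inl j) i : ℚ) * x i =
      (a j).1 - ((a j).2 : ℕ) * x (Fin.castAdd s j).succ := by
    simp [linearForms, sub_mul, Finset.sum_sub_distrib, Pi.single_apply, hx]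
  rw [this, RatCode.toRat, eq_div_iff h0]
  constructor <;> intro h <;> linarith

/-- Every denominator divides `commonDen`, so the scaled coefficient is an integer and passing to
its numerator loses nothing. -/
theorem BasicSystem.intCoeff_cast (j : Fin l) (i : Fin (t + s + 1)) :
    (S.intCoeff j i : ℚ) =
      S.commonDen j * (Fin.cons (S.const j) (S.coeff j) : Fin (t + s + 1) → ℚ) i := by
  have key : ∀ (N : ℕ) (r : ℚ), r.den ∣ N → (((N : ℚ) * r).num : ℚ) = N * r := by
    rintro _ r ⟨m, rfl⟩
    have : ((r.den * m : ℕ) : ℚ) * r = ((r.num * m : ℤ) : ℚ) := by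
      push_cast
      rw [mul_right_comm, mul_comm (r.den : ℚ), Rat.mul_den_eq_num]
    rw [this, Rat.num_intCast]
  refine Fin.cases ?_ (fun i => ?_) i
  · simp only [intCoeff, Fin.cons_zero]
    exact key _ _ (Dvd.intro _ rfl)
  · simp only [intCoeff, Fin.cons_succ]
    exact key _ _ (Dvd.dvd.mul_left (Finset.dvd_prod_of_mem _ (Finset.mem_univ i)) _)

theorem BasicSystem.linearForms_inr_eq_zero_iff (j : Fin l) (x : Fin (t + s + 1) → ℚ)
    (hx : x 0 = 1) :
    ∑ i, (S.linearForms a (.inr j) i : ℚ) * x i = 0 ↔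
      S.const j + ∑ i, S.coeff j i * x i.succ = 0 := by
  have h0 : (S.commonDen j : ℚ) ≠ 0 := by
    have : S.commonDen j ≠ 0 :=
      mul_ne_zero (S.const j).den_nz (Finset.prod_ne_zero_iff.2 fun i _ => (S.coeff j i).den_nz)
    exact_mod_cast this
  have : ∑ i, (S.linearForms a (.inr j) i : ℚ) * x i =
      S.commonDen j * (S.const j + ∑ i, S.coeff j i * x i.succ) := by
    simp only [linearForms, intCoeff_cast]
    rw [Fin.sum_univ_succ, mul_add, Finset.mul_sum]
    simp [hx, mul_assoc]
  rw [this, mul_eq_zero, or_iff_right h0]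

theorem BasicSystem.mem_rationalZeros_iff {q : ℕ} (S : BasicSystem q k l) (x : Fin q → ℚ) :
    x ∈ rationalZeros S.polys ↔ (∀ j, S.const j + ∑ i, S.coeff j i * x i = 0) ∧
      ∀ m, x (S.i₁ m) * x (S.i₂ m) = x (S.i₃ m) := by
  simp only [rationalZeros, polys, Set.mem_union, Set.mem_range, Set.mem_ofPred_eq, or_imp,
    forall_and, forall_exists_index, forall_apply_eq_imp_iff]
  simp [sub_eq_zero]

/-- The extra coordinate x₀ = 1 makes the affine equations linear. The forms p_j x₀ - q_j x_j fix
the first `t` variables at the parameters, and the remaining coordinates give `b`. -/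
theorem BasicSystem.exists_append_mem_rationalZeros_iff :
    (∃ b : Fin s → ℚ, Fin.append (fun j => (a j).toRat) b ∈ rationalZeros S.polys) ↔
      S.matrices a ∈ matrixRealizers 2 MatrixIndex.rank := by
  rw [S.mem_matrixRealizers_iff]
  constructor
  · rintro ⟨b, hb⟩
    obtain ⟨hb1, hb2⟩ := (S.mem_rationalZeros_iff _).1 hb
    set y := Fin.append (fun j => (a j).toRat) b with hy
    refine exists_encodesSolution (x := (Fin.cons 1 y : Fin (t + s + 1) → ℚ)) ?_
      (S.linearHoms_apply a) rfl ?_ ?_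
    · intro U V
      refine ⟨Sum.elim U V, fun i => ?_, fun i => ?_⟩
      · rw [dotHom_rowU]
        rfl
      · rw [dotHom_rowV]
        rfl
    · intro m
      simpa using hb2 m
    · rintro (j | j)
      · rw [S.linearForms_inl_eq_zero_iff a j _ rfl]
        simp [hy]
      · rw [S.linearForms_inr_eq_zero_iff a j _ rfl]
        simpa using hb1 j
  · rintro ⟨H, hH⟩
    obtain ⟨x, hx0, hmul, hlin⟩ := hH.exists_solution (fun w hu hv => by
      ext (i | i)
      · have := hu i
        rwa [dotHom_rowU] at this
      · have := hv i
        rwa [dotHom_rowV] at this) (S.linearHoms_apply a)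
    refine ⟨fun i => x (Fin.natAdd t i).succ, ?_⟩
    have happ : Fin.append (fun j => (a j).toRat) (fun i => x (Fin.natAdd t i).succ) =
        fun i => x i.succ := by
      funext i
      refine Fin.addCases (fun j => ?_) (fun j => ?_) i
      · rw [Fin.append_left, (S.linearForms_inl_eq_zero_iff a j x hx0).1 (hlin (.inl j))]
      · rw [Fin.append_right]
    rw [happ, S.mem_rationalZeros_iff]
    exact ⟨fun j => (S.linearForms_inr_eq_zero_iff a j x hx0).1 (hlin (.inr j)), hmul⟩

/-- Only the `param` matrices depend on `a`; their entries that may be non-zero are p_j and -q_j in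
the first row. -/
theorem BasicSystem.computable_matrices (i : MatrixIndex (t + s) k t l) (x y : Coord (t + s)) :
    Computable fun a : Fin t → RatCode => S.matrices a i x y := by
  rcases i with _ | _ | _ | _ | j | j | j | j
  case param =>
    have hj : Primrec fun a : Fin t → RatCode => a j :=
      Primrec.fin_app.comp Primrec.id (Primrec.const j)
    by_cases hx : x = Sum.inl 0
    · by_cases hy : y = Sum.inl 0
      · refine (primrec_fst hj).to_comp.of_eq fun a => ?_
        simp [matrices, oneRow, hx, hy, rowU, (Fin.succ_ne_zero _).symm]
      · by_cases hy' : y = Sum.inl (Fin.castAdd s j).succ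
        · have : Primrec fun a : Fin t → RatCode => -(((a j).2 : ℕ) : ℤ) :=
          primrec_int_neg (primrec_int_natCast (primrec_pnat_val (primrec_snd hj)))
          refine this.to_comp.of_eq fun a => ?_
          simp [matrices, oneRow, hx, hy', rowU]
        · refine (Computable.const 0).of_eq fun a => ?_
          simp [matrices, oneRow, hx, hy, hy', rowU]
    · refine (Computable.const 0).of_eq fun a => ?_
      simp [matrices, oneRow, hx]
  all_goals exact Computable.const _

end Matrices

end HBL

namespace HBL

open Module

/-! ### Realized tuples of coded data -/

/-- The rank of the image of `H` in a coded target group. -/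
noncomputable def TargetCode.imageRank {d : ℕ} (H : AddSubgroup (Fin d → ℤ)) (c : TargetCode) : ℕ :=
  finrank ℤ (H.map (c.hom d))

theorem mem_image_rankTuples_iff (d : ℕ) (T : List TargetCode) (r : ℕ) (ρ : List ℕ) :
    (r, ρ) ∈ (fun p : ℕ × (Fin (DatumCode.toDatum (d, T)).m → ℕ) => (p.1, List.ofFn p.2)) ''
      (DatumCode.toDatum (d, T)).rankTuples ↔
    ∃ H : AddSubgroup (Fin d → ℤ), finrank ℤ H = r ∧ ρ = T.map (TargetCode.imageRank H) := by
  constructor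
  · rintro ⟨p, ⟨H, h1, h2⟩, hp⟩
    obtain ⟨rfl, rfl⟩ := Prod.mk.inj hp
    refine ⟨H, h1, ?_⟩
    refine List.ext_getElem (by simp [DatumCode.toDatum]) fun i hi hi' => ?_
    rw [List.getElem_ofFn, List.getElem_map]
    exact (h2 _).symm
  · rintro ⟨H, rfl, rfl⟩
    refine ⟨(finrank ℤ H, fun j => TargetCode.imageRank H (T.get j)), ⟨H, rfl, fun j => rfl⟩, ?_⟩
    refine Prod.ext rfl ?_
    refine List.ext_getElem (by simp [DatumCode.toDatum]) fun i hi hi' => ?_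
    rw [List.getElem_ofFn, List.getElem_map]
    rfl

/-! ### Data given by sparse integer rows -/

/-- The coordinates of the row with the entries `z` at `c` for the listed pairs `(z, c)`. -/
def denseRow (d : ℕ) (r : List (ℤ × ℕ)) : List ℤ :=
  (List.range d).map fun c => (r.map fun e => if e.2 = c then e.1 else 0).sum

/-- The target `ℤⁿ`, with the homomorphism given by `n` sparse rows. -/
def rowTarget (d : ℕ) (rows : List (List (ℤ × ℕ))) : TargetCode :=
  (rows.length, [], rows.map fun r => denseRow d r)

/-- The functional on `ℤᵈ` given by a sparse row. -/
def rowHom (d : ℕ) (r : List (ℤ × ℕ)) : (Fin d → ℤ) →+ ℤ := dotHom (vec d (denseRow d r))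

/-- Terms are collected by column, and repeated columns add up. The ring is general because the
identity is needed over ℤ and over ℚ. -/
theorem list_sum_eq_sum_fin {R : Type*} [CommRing R] {d : ℕ} (r : List (ℤ × ℕ))
    (hr : ∀ e ∈ r, e.2 < d) (y : ℕ → R) :
    (r.map fun e => (e.1 : R) * y e.2).sum =
      ∑ i : Fin d, (((r.map fun e => if e.2 = (i : ℕ) then e.1 else 0).sum : ℤ) : R) * y i := by
  induction r with
  | nil => simp
  | cons e r ih =>
    have he := hr e List.mem_cons_self
    simp only [List.map_cons, List.sum_cons, Int.cast_add, add_mul, Finset.sum_add_distrib]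
    rw [← ih fun e' he' => hr e' (List.mem_cons_of_mem _ he')]
    congr 1
    rw [Finset.sum_eq_single ⟨e.2, he⟩]
    · simp
    · intro i _ hi
      rw [if_neg fun h => hi (Fin.ext h.symm)]
      simp
    · simp

/-- The extension by zero of a vector in `ℤᵈ`. -/
def extendVec {d : ℕ} (a : Fin d → ℤ) (i : ℕ) : ℤ := if h : i < d then a ⟨i, h⟩ else 0

theorem rowHom_apply {d : ℕ} (r : List (ℤ × ℕ)) (hr : ∀ e ∈ r, e.2 < d) (a : Fin d → ℤ) :
    rowHom d r a = (r.map fun e => e.1 * extendVec a e.2).sum := by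
  have := list_sum_eq_sum_fin (R := ℤ) r hr (extendVec a)
  simp only [Int.cast_id] at this
  rw [this, rowHom, dotHom_apply, dotProduct]
  refine Finset.sum_congr rfl fun i _ => ?_
  simp [vec, denseRow, extendVec]

theorem rowTarget_hom_eq_zero_iff {d : ℕ} (rows : List (List (ℤ × ℕ))) (a : Fin d → ℤ) :
    (rowTarget d rows).hom d a = 0 ↔ ∀ r ∈ rows, rowHom d r a = 0 := by
  have h0 : (rowTarget d rows).relations = ⊥ := by
    rw [TargetCode.relations, AddSubgroup.closure_eq_bot_iff]
    rintro v ⟨l, hl, -⟩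
    exact absurd hl List.not_mem_nil
  have h1 : (rowTarget d rows).hom d a = 0 ↔
      (mat rows.length d (rows.map fun r => denseRow d r)).mulVecLin a = 0 := by
    change QuotientAddGroup.mk' _ _ = 0 ↔ _
    rw [QuotientAddGroup.mk'_apply, QuotientAddGroup.eq_zero_iff, h0, AddSubgroup.mem_bot]
    rfl
  rw [h1, funext_iff, List.forall_mem_iff_getElem]
  rw [Fin.forall_iff]
  refine forall₂_congr fun i hi => ?_
  have : (mat rows.length d (rows.map fun r => denseRow d r)) ⟨i, hi⟩ =
      vec d (denseRow d rows[i]) := by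
    change vec d ((rows.map fun r => denseRow d r).getD i []) = _
    simp [hi]
  rw [rowHom, dotHom_apply, ← this]
  rfl

/-! ### The datum of a sparse system -/

/-- A bound for the codes of the monomials of a sparse system. -/
def monomialBound (S : List SparsePoly) : ℕ :=
  (S.map fun p => (p.map fun t => Encodable.encode t.2).sum).sum

theorem encode_le_monomialBound {S : List SparsePoly} {p : SparsePoly} (hp : p ∈ S)
    {t : ℤ × List ℕ} (ht : t ∈ p) : Encodable.encode t.2 ≤ monomialBound S := by
  have h1 : Encodable.encode t.2 ≤ (p.map fun t => Encodable.encode t.2).sum :=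
    List.le_sum_of_mem (List.mem_map.2 ⟨t, ht, rfl⟩)
  exact h1.trans (List.le_sum_of_mem (List.mem_map.2 ⟨p, hp, rfl⟩))

/-- The code of the one-letter word that starts the word with the code `n + 1`. -/
def headCode (n : ℕ) : ℕ := Nat.pair n.unpair.1 0 + 1

/-- The code of the tail of the word with the code `n + 1`. -/
def tailCode (n : ℕ) : ℕ := n.unpair.2

/-- Pairing is monotone in the second argument, and the tail of a one-letter word has the code 0.
Together with `tailCode_le` this keeps both factors of the word with code n + 1 among the unknowns
up to n + 1. -/
theorem headCode_le (n : ℕ) : headCode n ≤ n + 1 := by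
  have : Nat.pair n.unpair.1 0 ≤ Nat.pair n.unpair.1 n.unpair.2 :=
    StrictMono.monotone (fun _ _ h => Nat.pair_lt_pair_right _ h) (Nat.zero_le _)
  rw [Nat.pair_unpair] at this
  unfold headCode
  omega

theorem tailCode_le (n : ℕ) : tailCode n ≤ n := Nat.unpair_right_le n

/-- The linear form of a sparse polynomial in the codes of the monomials. -/
def SparsePoly.monomialForm (p : SparsePoly) : List (ℤ × ℕ) :=
  p.map fun t => (t.1, 2 * Encodable.encode t.2)

/-- Rows of homomorphisms, with the prescribed ranks of the images. The coordinates `u_i`, `v_i` for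
the monomial with code `i` are those with the numbers `2 * i` and `2 * i + 1`. -/
def rankConstraints (S : List SparsePoly) : List (List (List (ℤ × ℕ)) × ℕ) :=
  [([[(1, 0)]], 1), ([[(1, 1)]], 1),
    ((List.range (monomialBound S + 1)).map fun i => [(1, 2 * i)], 1),
    ((List.range (monomialBound S + 1)).map fun i => [(1, 2 * i + 1)], 1)] ++
  ((List.range (monomialBound S)).map fun j =>
    ([[(1, 0), (-1, 1)], [(1, 2 * (j + 1)), (-1, 2 * (j + 1) + 1)]], 1)) ++
  -- The non-empty word with code n + 1 is the product of its first letter and its tail.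
  ((List.range (monomialBound S)).map fun n =>
    ([[(1, 2 * headCode n), (1, 1)], [(1, 2 * (n + 1)), (1, 2 * tailCode n + 1)]], 1)) ++
  S.map fun p => ([p.monomialForm], 0)

def sparseDim (S : List SparsePoly) : ℕ := 2 * (monomialBound S + 1)

/-- The HBL datum of a sparse system. -/
def datumOfSparse (S : List SparsePoly) : DatumCode :=
  (sparseDim S, (rankConstraints S).map fun c => rowTarget (sparseDim S) c.1)

/-- The tuple that is realized if and only if the sparse system is solvable. -/
def tupleOfSparse (S : List SparsePoly) : ℕ × List ℕ := (2, (rankConstraints S).map fun c => c.2)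

theorem primrec_rankConstraints : Primrec rankConstraints := by
  unfold rankConstraints monomialBound headCode tailCode SparsePoly.monomialForm
  fun_prop

theorem primrec_datumOfSparse : Primrec datumOfSparse := by
  have := primrec_rankConstraints
  unfold datumOfSparse rowTarget denseRow sparseDim monomialBound
  fun_prop

theorem primrec_tupleOfSparse : Primrec tupleOfSparse := by
  have := primrec_rankConstraints
  unfold tupleOfSparse
  fun_prop

/-! ### Realizing the tuple is equivalent to solving the sparse system -/

section Realization

variable (S : List SparsePoly)

def monomialU (i : Fin (monomialBound S + 1)) : (Fin (sparseDim S) → ℤ) →+ ℤ :=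
  rowHom _ [(1, 2 * (i : ℕ))]

def monomialV (i : Fin (monomialBound S + 1)) : (Fin (sparseDim S) → ℤ) →+ ℤ :=
  rowHom _ [(1, 2 * (i : ℕ) + 1)]

theorem monomialU_apply (i : Fin (monomialBound S + 1)) (a : Fin (sparseDim S) → ℤ) :
    monomialU S i a = extendVec a (2 * i) := by
  have := i.2
  rw [monomialU, rowHom_apply]
  · simp
  · simp [sparseDim]
    omega

theorem monomialV_apply (i : Fin (monomialBound S + 1)) (a : Fin (sparseDim S) → ℤ) :
    monomialV S i a = extendVec a (2 * i + 1) := by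
  have := i.2
  rw [monomialV, rowHom_apply]
  · simp
  · simp [sparseDim]
    omega

def headIndex (m : Fin (monomialBound S)) : Fin (monomialBound S + 1) :=
  ⟨headCode m, (headCode_le m).trans_lt (by omega)⟩

def tailIndex (m : Fin (monomialBound S)) : Fin (monomialBound S + 1) :=
  ⟨tailCode m, (tailCode_le m).trans_lt (by omega)⟩

/-- The distinguished index 0 is the code of the empty word, whose monomial is 1. -/
def EncodesSparse (H : AddSubgroup (Fin (sparseDim S) → ℤ)) : Prop :=
  EncodesSolution 0 (monomialU S) (monomialV S) (headIndex S) (tailIndex S) Fin.succ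
    (fun p : {p // p ∈ S} => rowHom _ p.1.monomialForm) H

theorem rowHom_pair {d : ℕ} (z z' : ℤ) {c c' : ℕ} (hc : c < d) (hc' : c' < d) (a : Fin d → ℤ) :
    rowHom d [(z, c), (z', c')] a = z * extendVec a c + z' * extendVec a c' := by
  rw [rowHom_apply]
  · simp
  · simp [hc, hc']

theorem encodesSparse_iff (H : AddSubgroup (Fin (sparseDim S) → ℤ)) :
    EncodesSparse S H ↔ finrank ℤ H = 2 ∧
      ∀ c ∈ rankConstraints S, (rowTarget (sparseDim S) c.1).imageRank H = c.2 := by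
  have hU := finrank_map_eq_one_iff (f := (rowTarget (sparseDim S) [[(1, 0)]]).hom _)
    (g := fun _ : Unit => monomialU S 0)
    (fun a => by simp [rowTarget_hom_eq_zero_iff, monomialU]) H
  have hV := finrank_map_eq_one_iff (f := (rowTarget (sparseDim S) [[(1, 1)]]).hom _)
    (g := fun _ : Unit => monomialV S 0)
    (fun a => by simp [rowTarget_hom_eq_zero_iff, monomialV]) H
  have hUs := finrank_map_eq_one_iff (f := (rowTarget (sparseDim S)
    ((List.range (monomialBound S + 1)).map fun i => [(1, 2 * i)])).hom _) (g := monomialU S)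
    (fun a => by simp [rowTarget_hom_eq_zero_iff, monomialU, Fin.forall_iff]) H
  have hVs := finrank_map_eq_one_iff (f := (rowTarget (sparseDim S)
    ((List.range (monomialBound S + 1)).map fun i => [(1, 2 * i + 1)])).hom _) (g := monomialV S)
    (fun a => by simp [rowTarget_hom_eq_zero_iff, monomialV, Fin.forall_iff]) H
  have hE := fun j : Fin (monomialBound S) => finrank_map_eq_one_iff
    (f := (rowTarget (sparseDim S) [[(1, 0), (-1, 1)],
      [(1, 2 * ((j : ℕ) + 1)), (-1, 2 * ((j : ℕ) + 1) + 1)]]).hom _)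
    (g := ![monomialU S 0 - monomialV S 0, monomialU S j.succ - monomialV S j.succ])
    (fun a => by
      have := j.2
      simp only [rowTarget_hom_eq_zero_iff, List.forall_mem_cons, Fin.forall_fin_two,
        Matrix.cons_val_zero, Matrix.cons_val_one, AddMonoidHom.sub_apply, monomialU_apply,
        monomialV_apply, Fin.val_zero, Fin.val_succ]
      rw [rowHom_pair _ _ (by unfold sparseDim; omega) (by unfold sparseDim; omega),
        rowHom_pair _ _ (by unfold sparseDim; omega) (by unfold sparseDim; omega)]
      simp [sub_eq_add_neg]) H
  have hM := fun m : Fin (monomialBound S) => finrank_map_eq_one_iff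
    (f := (rowTarget (sparseDim S) [[(1, 2 * headCode m), (1, 1)],
      [(1, 2 * ((m : ℕ) + 1)), (1, 2 * tailCode m + 1)]]).hom _)
    (g := ![monomialU S (headIndex S m) + monomialV S 0,
      monomialU S m.succ + monomialV S (tailIndex S m)])
    (fun a => by
      have := m.2
      have := headCode_le m
      have := tailCode_le m
      simp only [rowTarget_hom_eq_zero_iff, List.forall_mem_cons, Fin.forall_fin_two,
        Matrix.cons_val_zero, Matrix.cons_val_one, AddMonoidHom.add_apply, monomialU_apply,
        monomialV_apply, Fin.val_zero, Fin.val_succ]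
      rw [rowHom_pair _ _ (by unfold sparseDim; omega) (by unfold sparseDim; omega),
        rowHom_pair _ _ (by unfold sparseDim; omega) (by unfold sparseDim; omega)]
      simp [headIndex, tailIndex]) H
  have hL := fun p : {p // p ∈ S} => finrank_map_eq_zero_iff
    (f := (rowTarget (sparseDim S) [p.1.monomialForm]).hom _)
    (g := fun _ : Unit => rowHom _ p.1.monomialForm)
    (fun a => by simp [rowTarget_hom_eq_zero_iff]) H
  constructor
  · intro h
    refine ⟨h.rank, fun c hc => ?_⟩
    simp only [rankConstraints, List.mem_append, List.mem_cons, List.mem_map, List.mem_range,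
      List.not_mem_nil, or_false] at hc
    rcases hc with (((rfl | rfl | rfl | rfl) | ⟨j, hj, rfl⟩) | ⟨m, hm, rfl⟩) | ⟨p, hp, rfl⟩
    · exact hU.2 h.u_o
    · exact hV.2 h.v_o
    · exact hUs.2 h.u_all
    · exact hVs.2 h.v_all
    · exact (hE ⟨j, hj⟩).2 (h.eq _ (Fin.succ_ne_zero _))
    · exact (hM ⟨m, hm⟩).2 (h.mul _)
    · exact (hL ⟨p, hp⟩).2 fun a ha _ => h.lin ⟨p, hp⟩ a ha
  · rintro ⟨hr, h⟩
    simp only [rankConstraints, List.forall_mem_append, List.forall_mem_cons,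
      List.forall_mem_map, List.mem_range] at h
    obtain ⟨⟨⟨⟨h1, h2, h3, h4, -⟩, h5⟩, h6⟩, h7⟩ := h
    refine ⟨hr, hU.1 h1, hV.1 h2, hUs.1 h3, hVs.1 h4, ?_, fun m => (hM m).1 (h6 m m.2),
      fun p a ha => (hL p).1 (h7 p.1 p.2) a ha ()⟩
    intro j hj
    obtain ⟨j, rfl⟩ := Fin.exists_succ_eq.2 hj
    exact (hE j).1 (h5 j j.2)

/-- The unknown with code n stands for the value of the monomial with code n. By induction on words,
y₀ = 1 and the product equations force this value, the point being read off from the one-letter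
words; tails have smaller codes, so the induction stays below the bound. -/
theorem sparseSolvable_iff_exists_monomials :
    SparseSolvable S ↔ ∃ y : Fin (monomialBound S + 1) → ℚ, y 0 = 1 ∧
      (∀ m, y (headIndex S m) * y (tailIndex S m) = y m.succ) ∧
      ∀ p : {p // p ∈ S}, ∑ i : Fin (monomialBound S + 1), (((p.1.map fun t =>
        if Encodable.encode t.2 = (i : ℕ) then t.1 else 0).sum : ℤ) : ℚ) * y i = 0 := by
  have hsum : ∀ p ∈ S, ∀ Y : ℕ → ℚ, (p.map fun t => (t.1 : ℚ) * Y (Encodable.encode t.2)).sum =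
      ∑ i : Fin (monomialBound S + 1), (((p.map fun t =>
        if Encodable.encode t.2 = (i : ℕ) then t.1 else 0).sum : ℤ) : ℚ) * Y i := by
    intro p hp Y
    have := list_sum_eq_sum_fin (d := monomialBound S + 1)
      (p.map fun t => (t.1, Encodable.encode t.2)) (by
        rintro _ he
        obtain ⟨t, ht, rfl⟩ := List.mem_map.1 he
        exact Nat.lt_succ_of_le (encode_le_monomialBound hp ht)) Y
    simpa only [List.map_map, Function.comp_def] using this
  constructor
  · rintro ⟨x, hx⟩
    let Y : ℕ → ℚ := fun n => ((Denumerable.ofNat (List ℕ) n).map x).prod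
    have hY : ∀ w : List ℕ, Y (Encodable.encode w) = (w.map x).prod := fun w => by
      simp only [Y]
      rw [show Encodable.encode w = (@Encodable.encode _ (Denumerable.denumerableList).toEncodable w)
        from rfl, Denumerable.ofNat_encode]
    refine ⟨fun i => Y i, hY [], fun m => ?_, fun p => ?_⟩
    · have h1 : headCode m = Encodable.encode [(m : ℕ).unpair.1] := rfl
      have h2 : tailCode m = Encodable.encode (Denumerable.ofNat (List ℕ) (m : ℕ).unpair.2) :=
        (Denumerable.encode_ofNat (α := List ℕ) _).symm
      have h3 : (m : ℕ) + 1 = Encodable.encode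
          ((m : ℕ).unpair.1 :: Denumerable.ofNat (List ℕ) (m : ℕ).unpair.2) := by
        rw [Encodable.encode_list_cons, ← h2]
        exact congrArg Nat.succ (Nat.pair_unpair m).symm
      simp only [headIndex, tailIndex, Fin.val_succ]
      rw [h1, h2, h3, hY, hY, hY]
      simp
    · rw [← hsum p.1 p.2 Y]
      simp only [hY]
      exact hx p.1 p.2
  · rintro ⟨y, hy0, hymul, hlin⟩
    -- The default 0 does no harm: a letter whose one-letter word has a code beyond the bound occurs
    -- in no monomial of the system.
    let Y : ℕ → ℚ := fun n => if h : n < monomialBound S + 1 then y ⟨n, h⟩ else 0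
    have hYy : ∀ i : Fin (monomialBound S + 1), Y i = y i := fun i => dif_pos i.2
    have hYw : ∀ w : List ℕ, Encodable.encode w ≤ monomialBound S →
        (w.map fun i => Y (Nat.pair i 0 + 1)).prod = Y (Encodable.encode w) := by
      intro w
      induction w with
      | nil => exact fun _ => hy0.symm.trans (hYy 0).symm
      | cons i w ih =>
        intro hw
        have he : Encodable.encode (i :: w) = Nat.pair i (Encodable.encode w) + 1 := rfl
        have hle : Encodable.encode w ≤ Nat.pair i (Encodable.encode w) := Nat.right_le_pair _ _
        -- Index n of the product equations belongs to the word with code n + 1, here i :: w.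
        have := hymul ⟨Nat.pair i (Encodable.encode w), by omega⟩
        rw [← hYy, ← hYy, ← hYy] at this
        simp only [headIndex, tailIndex, headCode, tailCode, Nat.unpair_pair, Fin.val_succ] at this
        rw [List.map_cons, List.prod_cons, ih (by omega), this, he]
    refine ⟨fun i => Y (Nat.pair i 0 + 1), fun p hp => ?_⟩
    have h1 := hlin ⟨p, hp⟩
    simp only [← hYy] at h1
    rw [← hsum p hp Y] at h1
    rw [← h1, SparsePoly.eval]
    congr 1
    refine List.map_congr_left fun t ht => ?_
    rw [hYw t.2 (encode_le_monomialBound hp ht)]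

theorem exists_encodesSparse_iff : (∃ H, EncodesSparse S H) ↔ SparseSolvable S := by
  have hl : ∀ (p : {p // p ∈ S}) a, rowHom (sparseDim S) p.1.monomialForm a =
      ∑ i : Fin (monomialBound S + 1), (p.1.map fun t =>
        if Encodable.encode t.2 = (i : ℕ) then t.1 else 0).sum * monomialU S i a := by
    intro p a
    have hle : ∀ t ∈ p.1, Encodable.encode t.2 < monomialBound S + 1 := fun t ht =>
      Nat.lt_succ_of_le (encode_le_monomialBound p.2 ht)
    rw [rowHom_apply]
    · have := list_sum_eq_sum_fin (R := ℤ) (d := monomialBound S + 1)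
        (p.1.map fun t => (t.1, Encodable.encode t.2)) (by
          rintro _ he
          obtain ⟨t, ht, rfl⟩ := List.mem_map.1 he
          exact hle t ht) fun i => extendVec a (2 * i)
      simpa only [List.map_map, Function.comp_def, Int.cast_id, monomialU_apply,
        SparsePoly.monomialForm] using this
    · intro e he
      obtain ⟨t, ht, rfl⟩ := List.mem_map.1 he
      have := hle t ht
      simp only [sparseDim]
      omega
  rw [sparseSolvable_iff_exists_monomials]
  constructor
  · rintro ⟨H, hH⟩
    refine EncodesSolution.exists_solution (fun a hu hv => ?_) hl hH
    funext i
    obtain ⟨i, hi⟩ := i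
    have hi' : i < 2 * (monomialBound S + 1) := hi
    rcases Nat.even_or_odd' i with ⟨k, rfl | rfl⟩
    · have := hu ⟨k, by omega⟩
      rwa [monomialU_apply, extendVec, dif_pos hi] at this
    · have := hv ⟨k, by omega⟩
      rwa [monomialV_apply, extendVec, dif_pos hi] at this
  · rintro ⟨y, hy0, hymul, hlin⟩
    refine exists_encodesSolution (fun U V => ?_) hl hy0 hymul hlin
    -- The coordinates u and v are interleaved: even places carry u, odd places carry v.
    refine ⟨fun i => if (i : ℕ) % 2 = 0 then U ⟨i / 2, ?_⟩ else V ⟨i / 2, ?_⟩, fun i => ?_,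
      fun i => ?_⟩
    · have : (i : ℕ) < 2 * (monomialBound S + 1) := i.2
      omega
    · have : (i : ℕ) < 2 * (monomialBound S + 1) := i.2
      omega
    · have h : 2 * (i : ℕ) < sparseDim S := by
        unfold sparseDim
        omega
      rw [monomialU_apply, extendVec, dif_pos h]
      simp
    · have h : 2 * (i : ℕ) + 1 < sparseDim S := by
        unfold sparseDim
        omega
      rw [monomialV_apply, extendVec, dif_pos h]
      simp [Nat.mul_add_div]

theorem tupleOfSparse_mem_iff :
    tupleOfSparse S ∈ (fun p : ℕ × (Fin (datumOfSparse S).toDatum.m → ℕ) =>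
      (p.1, List.ofFn p.2)) '' (datumOfSparse S).toDatum.rankTuples ↔ SparseSolvable S := by
  rw [← exists_encodesSparse_iff]
  refine (mem_image_rankTuples_iff _ _ _ _).trans (exists_congr fun H => ?_)
  rw [encodesSparse_iff, List.map_map, List.map_inj_left]
  simp only [Function.comp_apply, eq_comm]

end Realization

theorem computablePred_sparseSolvable_of_rankTuplesComputable (h : RankTuplesComputable) :
    ComputablePred SparseSolvable := by
  obtain ⟨F, hF, hFc⟩ := h
  have hmem : PrimrecRel fun (L : List (ℕ × List ℕ)) x => ∃ a ∈ L, a = x :=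
    PrimrecRel.exists_mem_list Primrec.eq
  refine ComputablePred.computable_iff.2 ⟨fun S => decide (∃ a ∈ F (datumOfSparse S),
    a = tupleOfSparse S), ?_, ?_⟩
  · exact hmem.decide.to_comp.comp (hF.comp primrec_datumOfSparse.to_comp)
      primrec_tupleOfSparse.to_comp
  · funext S
    rw [← tupleOfSparse_mem_iff, ← hFc]
    simp

end HBL

namespace HBL

open Module

/-! ### Ranks of subgroups and dimensions of rational subspaces -/

/-- The kernel is torsion, so the rank is that of the range. The range is finitely generated and
torsion-free, hence free, and a ℤ-basis of it is a ℚ-basis of its span. -/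
theorem finrank_int_eq_finrank_span {A V : Type*} [AddCommGroup A] [Module.Finite ℤ A]
    [AddCommGroup V] [Module ℚ V] (f : A →ₗ[ℤ] V)
    (hf : ∀ a, f a = 0 → ∃ n : ℤ, n ≠ 0 ∧ n • a = 0) :
    finrank ℤ A = finrank ℚ (Submodule.span ℚ (Set.range f)) := by
  have hker : LinearMap.ker f ≤ Submodule.torsion ℤ A := fun a ha => by
    obtain ⟨n, hn, hna⟩ := hf a ha
    exact ⟨⟨n, mem_nonZeroDivisors_of_ne_zero hn⟩, hna⟩
  have h1 : finrank ℤ (A ⧸ LinearMap.ker f) = finrank ℤ A :=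
    congrArg Cardinal.toNat (rank_quotient_eq_of_le_torsion hker)
  have h2 := f.quotKerEquivRange.finrank_eq
  have : IsAddTorsionFree V := IsAddTorsionFree.of_module_rat V
  have : Module.Finite ℤ (LinearMap.range f) := inferInstance
  have : Module.Free ℤ (LinearMap.range f) := Module.free_of_finite_type_torsion_free'
  let b := finBasis ℤ (LinearMap.range f)
  have hb : LinearIndependent ℚ fun i => (b i : V) := by
    rw [← LinearIndependent.iff_fractionRing ℤ ℚ]
    exact b.linearIndependent.map' (LinearMap.range f).subtype (Submodule.ker_subtype _)
  have hspan : Submodule.span ℚ (Set.range f) = Submodule.span ℚ (Set.range fun i => (b i : V)) := by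
    apply le_antisymm
    · rw [Submodule.span_le]
      rintro _ ⟨a, rfl⟩
      have h3 := congrArg (LinearMap.range f).subtype (b.sum_repr ⟨f a, a, rfl⟩)
      rw [map_sum] at h3
      simp only [map_smul, Submodule.subtype_apply] at h3
      rw [SetLike.mem_coe, ← h3]
      refine Submodule.sum_mem _ fun i _ => ?_
      refine zsmul_mem (Submodule.subset_span ?_) _
      exact ⟨i, rfl⟩
    · refine Submodule.span_mono ?_
      rintro _ ⟨i, rfl⟩
      exact (b i).2
  rw [← h1, h2, hspan, finrank_span_eq_card hb, Fintype.card_fin]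

theorem finrank_submodule_eq_finrank_span {A V : Type*} [AddCommGroup A] [AddCommGroup V]
    [Module ℚ V] (K : Submodule ℤ A) [Module.Finite ℤ K] (f : A →ₗ[ℤ] V)
    (hf : ∀ a, f a = 0 → ∃ n : ℤ, n ≠ 0 ∧ n • a = 0) :
    finrank ℤ K = finrank ℚ (Submodule.span ℚ (f '' K)) := by
  have h1 : f '' K = Set.range (f ∘ₗ K.subtype) := by
    rw [LinearMap.coe_comp, Set.range_comp, Submodule.coe_subtype, Subtype.range_coe]
  rw [h1]
  refine finrank_int_eq_finrank_span _ fun a ha => ?_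
  obtain ⟨n, hn, hna⟩ := hf a ha
  exact ⟨n, hn, Subtype.ext hna⟩

/-- The inclusion `ℤⁿ → ℚⁿ`. -/
def castVec (n : Type*) : (n → ℤ) →ₗ[ℤ] (n → ℚ) where
  toFun v i := v i
  map_add' v w := by
    ext
    simp
  map_smul' z v := by
    ext
    simp

@[simp]
theorem castVec_apply {n : Type*} (v : n → ℤ) (i : n) : castVec n v i = v i := rfl

theorem castVec_injective (n : Type*) : Function.Injective (castVec n) := fun v w h => by
  funext i
  have := congrFun h i
  rwa [castVec_apply, castVec_apply, Int.cast_inj] at this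

theorem castVec_mulVec {m n : Type*} [Fintype n] (M : Matrix m n ℤ) (v : n → ℤ) :
    castVec m (M.mulVec v) = (M.map (Int.cast : ℤ → ℚ)).mulVec (castVec n v) := by
  funext i
  simp [Matrix.mulVec, dotProduct]

/-- The rational subspace spanned by a subgroup of `ℤⁿ`. -/
def rationalSpan {n : Type*} (H : AddSubgroup (n → ℤ)) : Submodule ℚ (n → ℚ) :=
  Submodule.span ℚ (castVec n '' H)

theorem finrank_eq_finrank_rationalSpan {n : Type*} [Finite n] (H : AddSubgroup (n → ℤ)) :
    finrank ℤ H = finrank ℚ (rationalSpan H) := by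
  have : Module.Finite ℤ (AddSubgroup.toIntSubmodule H) := inferInstance
  exact finrank_submodule_eq_finrank_span (AddSubgroup.toIntSubmodule H) (castVec n) fun a ha =>
    ⟨1, one_ne_zero, by rw [one_smul, castVec_injective n (ha.trans (map_zero _).symm)]⟩

/-- The columns are the relations of the code. -/
def TargetCode.relationMatrix (t : TargetCode) : Matrix (Fin t.1) (Fin t.2.1.length) ℤ :=
  Matrix.of fun i e => (t.2.1.getD e []).getD i 0

theorem TargetCode.relations_eq (t : TargetCode) :
    t.relations = (LinearMap.range t.relationMatrix.mulVecLin).toAddSubgroup := by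
  have h : {v | ∃ l ∈ t.2.1, v = vec t.1 l} = Set.range t.relationMatrix.col := by
    ext v
    constructor
    · rintro ⟨l, hl, rfl⟩
      obtain ⟨i, hi, rfl⟩ := List.getElem_of_mem hl
      refine ⟨⟨i, hi⟩, ?_⟩
      funext k
      simp [relationMatrix, vec]
    · rintro ⟨⟨i, hi⟩, rfl⟩
      refine ⟨t.2.1[i], List.getElem_mem hi, ?_⟩
      funext k
      simp [relationMatrix, vec]
  rw [Matrix.range_mulVecLin, relations, h, Submodule.span_int_eq_addSubgroupClosure]

/-- The rational subspace spanned by the relations. -/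
abbrev TargetCode.relationSpace (t : TargetCode) : Submodule ℚ (Fin t.1 → ℚ) :=
  LinearMap.range (t.relationMatrix.map (Int.cast : ℤ → ℚ)).mulVecLin

/-- A rational combination of the relations becomes an integral one on clearing denominators. -/
theorem TargetCode.castVec_mem_relationSpace_iff (t : TargetCode) (v : Fin t.1 → ℤ) :
    castVec _ v ∈ t.relationSpace ↔ ∃ n : ℤ, n ≠ 0 ∧ n • v ∈ t.relations := by
  rw [relations_eq]
  constructor
  · rintro ⟨w, hw⟩
    obtain ⟨⟨n, hn⟩, hnw⟩ := IsLocalization.exist_integer_multiples_of_finite (nonZeroDivisors ℤ) w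
    choose W hW using hnw
    refine ⟨n, nonZeroDivisors.ne_zero hn, W, castVec_injective _ ?_⟩
    have hW' : castVec _ W = n • w := by
      funext i
      simpa using hW i
    rw [Matrix.mulVecLin_apply, castVec_mulVec, hW', map_zsmul, ← hw]
    exact map_zsmul (Matrix.mulVecLin _) n w
  · rintro ⟨n, hn, w, hw⟩
    have hn' : (n : ℚ) ≠ 0 := by exact_mod_cast hn
    have h1 : (n : ℚ) • castVec _ v ∈ t.relationSpace := by
      refine ⟨castVec _ w, ?_⟩
      rw [Matrix.mulVecLin_apply, ← castVec_mulVec, ← Matrix.mulVecLin_apply, hw, map_zsmul]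
      exact (Int.cast_smul_eq_zsmul ℚ n _).symm
    exact (Submodule.smul_mem_iff _ hn').1 h1

/-- The rational form of the homomorphism of a coded target. -/
def TargetCode.rationalMap (d : ℕ) (t : TargetCode) :
    (Fin d → ℚ) →ₗ[ℚ] (Fin t.1 → ℚ) ⧸ t.relationSpace :=
  t.relationSpace.mkQ ∘ₗ ((mat t.1 d t.2.2).map (Int.cast : ℤ → ℚ)).mulVecLin

/-- The map from the coded group to ℚⁿ modulo the relation space has only torsion in its kernel, so
it preserves ranks, and it intertwines the coded homomorphism with its rational form. -/
theorem TargetCode.imageRank_eq {d : ℕ} (H : AddSubgroup (Fin d → ℤ)) (t : TargetCode) :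
    t.imageRank H = finrank ℚ ((rationalSpan H).map (t.rationalMap d)) := by
  let g : t.Group →+ (Fin t.1 → ℚ) ⧸ t.relationSpace :=
    QuotientAddGroup.lift t.relations
      (t.relationSpace.mkQ.toAddMonoidHom.comp (castVec _).toAddMonoidHom) fun v hv => by
        refine (Submodule.Quotient.mk_eq_zero _).2 ((t.castVec_mem_relationSpace_iff v).2
          ⟨1, one_ne_zero, ?_⟩)
        rwa [one_smul]
  have hg : ∀ v, g (QuotientAddGroup.mk' _ v) = t.relationSpace.mkQ (castVec _ v) := fun v => rfl
  have hker : ∀ x, g x = 0 → ∃ n : ℤ, n ≠ 0 ∧ n • x = 0 := by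
    intro x hx
    obtain ⟨v, rfl⟩ := QuotientAddGroup.mk'_surjective t.relations x
    rw [hg] at hx
    obtain ⟨n, hn, hnv⟩ := (t.castVec_mem_relationSpace_iff v).1
      ((Submodule.Quotient.mk_eq_zero _).1 hx)
    refine ⟨n, hn, ?_⟩
    rw [← map_zsmul]
    exact (QuotientAddGroup.eq_zero_iff _).2 hnv
  have hfin : Module.Finite ℤ (AddSubgroup.toIntSubmodule (H.map (t.hom d))) :=
    finite_addSubgroup_map H (t.hom d)
  refine (finrank_submodule_eq_finrank_span (AddSubgroup.toIntSubmodule (H.map (t.hom d)))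
    g.toIntLinearMap hker).trans ?_
  rw [rationalSpan, Submodule.map_span]
  have hcomp : ∀ a, g (t.hom d a) = t.rationalMap d (castVec _ a) := fun a => by
    change t.relationSpace.mkQ (castVec _ ((mat t.1 d t.2.2).mulVec a)) = _
    rw [castVec_mulVec]
    rfl
  refine congrArg (fun s : Set _ => finrank ℚ (Submodule.span ℚ s)) ?_
  ext y
  constructor
  · rintro ⟨_, ⟨a, ha, rfl⟩, rfl⟩
    exact ⟨_, ⟨a, ha, rfl⟩, (hcomp a).symm⟩
  · rintro ⟨_, ⟨a, ha, rfl⟩, rfl⟩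
    exact ⟨_, ⟨a, ha, rfl⟩, hcomp a⟩

/-! ### Certificates for ranks -/

section Factorization

variable {n r ℓ ρ : ℕ} {N : Matrix (Fin n) (Fin r) ℚ} {R : Matrix (Fin n) (Fin ℓ) ℚ}

/-- Modulo the columns of `R`, `N` equals C D. Here `D` is onto because of `U`, and `C` stays
injective in the quotient because `L` kills `R` and inverts `C` on the left. -/
theorem finrank_range_mkQ_comp_of_factorization {C : Matrix (Fin n) (Fin ρ) ℚ}
    {D : Matrix (Fin ρ) (Fin r) ℚ} {E : Matrix (Fin ℓ) (Fin r) ℚ} {L : Matrix (Fin ρ) (Fin n) ℚ}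
    {U : Matrix (Fin r) (Fin ρ) ℚ} (hN : N + R * E = C * D) (hLR : L * R = 0) (hLC : L * C = 1)
    (hDU : D * U = 1) :
    finrank ℚ (LinearMap.range ((LinearMap.range R.mulVecLin).mkQ ∘ₗ N.mulVecLin)) = ρ := by
  have hTD : (LinearMap.range R.mulVecLin).mkQ ∘ₗ N.mulVecLin =
      ((LinearMap.range R.mulVecLin).mkQ ∘ₗ C.mulVecLin) ∘ₗ D.mulVecLin := by
    refine LinearMap.ext fun w => ?_
    simp only [LinearMap.comp_apply, Matrix.mulVecLin_apply, Matrix.mulVec_mulVec, ← hN,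
      Matrix.add_mulVec, map_add]
    rw [left_eq_add]
    refine (Submodule.Quotient.mk_eq_zero _).2 ⟨E.mulVec w, ?_⟩
    rw [Matrix.mulVecLin_apply, Matrix.mulVec_mulVec]
  have hDs : LinearMap.range D.mulVecLin = ⊤ := by
    rw [LinearMap.range_eq_top]
    intro v
    exact ⟨U.mulVec v, by rw [Matrix.mulVecLin_apply, Matrix.mulVec_mulVec, hDU, Matrix.one_mulVec]⟩
  have hinj : Function.Injective ((LinearMap.range R.mulVecLin).mkQ ∘ₗ C.mulVecLin) := by
    rw [← LinearMap.ker_eq_bot, LinearMap.ker_eq_bot']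
    intro v hv
    obtain ⟨w, hw⟩ := (Submodule.Quotient.mk_eq_zero _).1 hv
    have h1 : L.mulVec (C.mulVec v) = L.mulVec (R.mulVec w) := congrArg L.mulVec hw.symm
    rwa [Matrix.mulVec_mulVec, Matrix.mulVec_mulVec, hLC, hLR, Matrix.one_mulVec,
      Matrix.zero_mulVec] at h1
  rw [hTD, LinearMap.range_comp_of_range_eq_top _ hDs, LinearMap.finrank_range_of_inj hinj]
  simp

/-- From a basis of the range: `C` lifts it to ℚⁿ, `D` gives the coordinates of the images, `U`
collects preimages, `L` extends the coordinates to the whole quotient, and `E` corrects the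
difference by relations. -/
theorem exists_factorization_of_finrank_range
    (hρ : finrank ℚ (LinearMap.range ((LinearMap.range R.mulVecLin).mkQ ∘ₗ N.mulVecLin)) = ρ) :
    ∃ (C : Matrix (Fin n) (Fin ρ) ℚ) (D : Matrix (Fin ρ) (Fin r) ℚ)
      (E : Matrix (Fin ℓ) (Fin r) ℚ) (L : Matrix (Fin ρ) (Fin n) ℚ)
      (U : Matrix (Fin r) (Fin ρ) ℚ),
      N + R * E = C * D ∧ L * R = 0 ∧ L * C = 1 ∧ D * U = 1 := by
  obtain ⟨W, hW⟩ : ∃ W, W = LinearMap.range R.mulVecLin := ⟨_, rfl⟩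
  rw [← hW] at hρ
  obtain ⟨T, hT⟩ : ∃ T, T = W.mkQ ∘ₗ N.mulVecLin := ⟨_, rfl⟩
  rw [← hT] at hρ
  have b := finBasisOfFinrankEq ℚ (LinearMap.range T) hρ
  choose c hc using fun a => W.mkQ_surjective (b a : (Fin n → ℚ) ⧸ W)
  choose u hu using fun a => (b a).2
  obtain ⟨g, hg⟩ := LinearMap.exists_leftInverse_of_injective
    ((LinearMap.range T).subtype ∘ₗ b.equivFun.symm.toLinearMap)
    (LinearMap.ker_eq_bot.2 (Subtype.val_injective.comp b.equivFun.symm.injective))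
  have hgb : ∀ a, g (b a) = Pi.single a 1 := fun a => by
    have := LinearMap.congr_fun hg (Pi.single a 1)
    simpa using this
  obtain ⟨D, hD⟩ : ∃ D : Matrix (Fin ρ) (Fin r) ℚ, ∀ w, D.mulVec w =
      b.equivFun (T.rangeRestrict w) :=
    ⟨_, LinearMap.toMatrix'_mulVec (b.equivFun.toLinearMap ∘ₗ T.rangeRestrict)⟩
  obtain ⟨L, hL⟩ : ∃ L : Matrix (Fin ρ) (Fin n) ℚ, ∀ w, L.mulVec w = g (W.mkQ w) :=
    ⟨_, LinearMap.toMatrix'_mulVec (g ∘ₗ W.mkQ)⟩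
  obtain ⟨C, hC⟩ : ∃ C : Matrix (Fin n) (Fin ρ) ℚ, ∀ i a, C i a = c a i :=
    ⟨Matrix.of fun i a => c a i, fun _ _ => rfl⟩
  have hCD : ∀ w, W.mkQ (C.mulVec (D.mulVec w)) = T w := by
    intro w
    have h1 : C.mulVec (D.mulVec w) = ∑ a, D.mulVec w a • c a := by
      funext i
      simp only [Matrix.mulVec.eq_1 C, dotProduct, Finset.sum_apply, Pi.smul_apply, smul_eq_mul, hC]
      exact Finset.sum_congr rfl fun a _ => mul_comm _ _
    rw [h1, map_sum]
    simp only [map_smul, hc, hD]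
    have h2 := congrArg (LinearMap.range T).subtype (b.sum_equivFun (T.rangeRestrict w))
    rw [map_sum] at h2
    simp only [map_smul] at h2
    exact h2
  -- The columns of C D - N vanish in the quotient, so they are combinations of the columns of `R`.
  have hE : ∀ k : Fin r, ∃ e, R.mulVec e =
      C.mulVec (D.mulVec (Pi.single k 1)) - N.mulVec (Pi.single k 1) := by
    intro k
    have : C.mulVec (D.mulVec (Pi.single k 1)) - N.mulVec (Pi.single k 1) ∈ W := by
      rw [← Submodule.Quotient.mk_eq_zero, Submodule.Quotient.mk_sub, sub_eq_zero]
      exact (hCD _).trans (LinearMap.congr_fun hT _)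
    rw [hW] at this
    exact this
  choose e he using hE
  refine ⟨C, D, Matrix.of fun i k => e k i, L, Matrix.of fun k a => u a k, ?_, ?_, ?_, ?_⟩
  · ext i k
    have h1 := congrFun (he k) i
    rw [Pi.sub_apply, Matrix.mulVec_mulVec, Matrix.mulVec_single_one, Matrix.mulVec_single_one] at h1
    exact (sub_eq_iff_eq_add'.1 h1.symm).symm
  · ext a k
    have h1 : W.mkQ (R.col k) = 0 := by
      refine (Submodule.Quotient.mk_eq_zero _).2 ?_
      rw [hW]
      exact ⟨Pi.single k 1, (Matrix.mulVecLin_apply _ _).trans (Matrix.mulVec_single_one _ _)⟩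
    have h2 := hL (R.col k)
    rw [h1, map_zero] at h2
    exact congrFun h2 a
  · ext a a'
    have h2 := hL (c a')
    rw [hc, hgb] at h2
    have h3 : (L * C) a a' = L.mulVec (c a') a := by
      simp only [Matrix.mul_apply, Matrix.mulVec, dotProduct, hC]
    rw [h3, h2, Matrix.one_apply, Pi.single_apply]
  · ext a a'
    have h2 := hD (u a')
    have h3 : T.rangeRestrict (u a') = b a' := Subtype.ext (hu a')
    rw [h3] at h2
    refine (congrFun h2 a).trans ?_
    rw [b.equivFun_self, Matrix.one_apply]
    simp only [eq_comm]

end Factorization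

/-- Matrices which show that the coded homomorphism maps the column space of `B` to a space of
dimension `ρ`. -/
def TargetCode.HasCertificate {d r : ℕ} (B : Matrix (Fin d) (Fin r) ℚ) (t : TargetCode) (ρ : ℕ) :
    Prop :=
  ∃ (C : Matrix (Fin t.1) (Fin ρ) ℚ) (D : Matrix (Fin ρ) (Fin r) ℚ)
    (E : Matrix (Fin t.2.1.length) (Fin r) ℚ) (L : Matrix (Fin ρ) (Fin t.1) ℚ)
    (U : Matrix (Fin r) (Fin ρ) ℚ),
    (mat t.1 d t.2.2).map (Int.cast : ℤ → ℚ) * B +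
      t.relationMatrix.map (Int.cast : ℤ → ℚ) * E = C * D ∧
    L * t.relationMatrix.map (Int.cast : ℤ → ℚ) = 0 ∧ L * C = 1 ∧ D * U = 1

theorem TargetCode.imageRank_eq_iff {d r : ℕ} {H : AddSubgroup (Fin d → ℤ)}
    {B : Matrix (Fin d) (Fin r) ℚ} (hB : rationalSpan H = LinearMap.range B.mulVecLin)
    (t : TargetCode) (ρ : ℕ) : t.imageRank H = ρ ↔ t.HasCertificate B ρ := by
  rw [imageRank_eq, hB, ← LinearMap.range_comp, rationalMap, LinearMap.comp_assoc,
    ← Matrix.mulVecLin_mul]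
  constructor
  · exact exists_factorization_of_finrank_range
  · rintro ⟨C, D, E, L, U, h1, h2, h3, h4⟩
    exact finrank_range_mkQ_comp_of_factorization h1 h2 h3 h4

/-- The columns of `B` are a basis of the rational span of `H`, and `B'` certifies their
independence. The image ranks depend on that span only, so any subgroup with the right span serves
in the converse. -/
theorem exists_addSubgroup_iff_exists_matrix {d : ℕ} (T : List TargetCode) (r : ℕ) (ρ : List ℕ) :
    (∃ H : AddSubgroup (Fin d → ℤ), finrank ℤ H = r ∧ ρ = T.map (TargetCode.imageRank H)) ↔
      ρ.length = T.length ∧ ∃ (B : Matrix (Fin d) (Fin r) ℚ) (B' : Matrix (Fin r) (Fin d) ℚ),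
        B' * B = 1 ∧ ∀ j : Fin T.length, (T.get j).HasCertificate B (ρ.getD j 0) := by
  constructor
  · rintro ⟨H, hr, rfl⟩
    refine ⟨List.length_map _, ?_⟩
    have hr' : finrank ℤ (AddSubgroup.toIntSubmodule H) = r := hr
    let h := finBasisOfFinrankEq ℤ (AddSubgroup.toIntSubmodule H) hr'
    let B : Matrix (Fin d) (Fin r) ℚ := Matrix.of fun k i => ((h i : Fin d → ℤ) k : ℚ)
    have hBcol : B.col = fun i => castVec _ (h i : Fin d → ℤ) := rfl
    have hspan : rationalSpan H = LinearMap.range B.mulVecLin := by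
      rw [Matrix.range_mulVecLin, rationalSpan, hBcol]
      apply le_antisymm
      · rw [Submodule.span_le]
        rintro _ ⟨a, ha, rfl⟩
        have h3 := congrArg (castVec _ ∘ₗ (AddSubgroup.toIntSubmodule H).subtype)
          (h.sum_repr ⟨a, ha⟩)
        rw [map_sum] at h3
        simp only [map_smul] at h3
        rw [SetLike.mem_coe, show castVec _ a = _ from h3.symm]
        refine Submodule.sum_mem _ fun i _ => ?_
        refine zsmul_mem (Submodule.subset_span ?_) _
        exact ⟨i, rfl⟩
      · refine Submodule.span_mono ?_
        rintro _ ⟨i, rfl⟩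
        exact ⟨_, (h i).2, rfl⟩
    have hinj : Function.Injective B.mulVecLin := by
      refine Matrix.mulVec_injective_iff.2 ?_
      rw [hBcol, ← LinearIndependent.iff_fractionRing ℤ ℚ]
      exact h.linearIndependent.map' (castVec _ ∘ₗ (AddSubgroup.toIntSubmodule H).subtype)
        (LinearMap.ker_eq_bot.2 ((castVec_injective _).comp Subtype.val_injective))
    obtain ⟨g, hg⟩ := LinearMap.exists_leftInverse_of_injective _ (LinearMap.ker_eq_bot.2 hinj)
    refine ⟨B, LinearMap.toMatrix' g, ?_, fun j => ?_⟩
    · apply Matrix.toLin'.injective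
      rw [Matrix.toLin'_mul, Matrix.toLin'_toMatrix', Matrix.toLin'_one]
      exact hg
    · rw [← TargetCode.imageRank_eq_iff hspan]
      simp
  · rintro ⟨hlen, B, B', hBB, hT⟩
    -- `H` will be generated by the columns of the integral matrix nB, which span the same rational
    -- subspace as those of `B`.
    obtain ⟨⟨n, hn⟩, hnB⟩ := IsLocalization.exist_integer_multiples_of_finite (nonZeroDivisors ℤ)
      fun p : Fin d × Fin r => B p.1 p.2
    have hn0 : (n : ℚ) ≠ 0 := by exact_mod_cast nonZeroDivisors.ne_zero hn
    choose Z hZ using hnB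
    let M : Matrix (Fin d) (Fin r) ℤ := Matrix.of fun k i => Z (k, i)
    have hM : M.map (Int.cast : ℤ → ℚ) = (n : ℚ) • B := by
      ext k i
      refine (?_ : (Z (k, i) : ℚ) = _)
      simpa using hZ (k, i)
    have hinj : Function.Injective B.mulVecLin := fun v w hvw => by
      have := congrArg B'.mulVec hvw
      simpa [hBB] using this
    let H := (LinearMap.range M.mulVecLin).toAddSubgroup
    have hspan : rationalSpan H = LinearMap.range B.mulVecLin := by
      apply le_antisymm
      · rw [rationalSpan, Submodule.span_le]
        rintro _ ⟨_, ⟨w, rfl⟩, rfl⟩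
        refine ⟨(n : ℚ) • castVec _ w, ?_⟩
        rw [Matrix.mulVecLin_apply, Matrix.mulVecLin_apply, castVec_mulVec, hM,
          Matrix.mulVec_smul, Matrix.smul_mulVec]
      · rw [Matrix.range_mulVecLin, Submodule.span_le]
        rintro _ ⟨i, rfl⟩
        rw [SetLike.mem_coe, ← Submodule.smul_mem_iff _ hn0]
        refine Submodule.subset_span ⟨M.mulVecLin (Pi.single i 1), ⟨_, rfl⟩, ?_⟩
        funext k
        have := congrFun (congrFun hM k) i
        simpa using this
    refine ⟨H, ?_, ?_⟩
    · rw [finrank_eq_finrank_rationalSpan, hspan, LinearMap.finrank_range_of_inj hinj]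
      simp
    · refine List.ext_getElem (by simpa using hlen) fun i hi hi' => ?_
      have hiT : i < T.length := by simpa using hi'
      have := (TargetCode.imageRank_eq_iff hspan _ _).2 (hT ⟨i, hiT⟩)
      rw [List.getElem_map]
      simpa [hi] using this.symm

end HBL

namespace HBL

open Module

/-! ### The sparse system of a coded datum and a tuple -/

/-- The variable for the entry `(a, b)` of the matrix of kind `k` for the target with index `j`. -/
def entryVar (k j a b : ℕ) : ℕ := Nat.pair k (Nat.pair j (Nat.pair a b))

/-- Equations for a matrix (of kind `1`) of size `d × r` to have a left inverse (of kind `0`). -/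
def leftInverseSystem (d r : ℕ) : List SparsePoly :=
  (List.range r).flatMap fun a => (List.range r).map fun b =>
    ((List.range d).map fun i => ((1 : ℤ), [entryVar 0 0 a i, entryVar 1 0 i b])) ++
      [(if a = b then -1 else 0, [])]

/-- Equations for the matrices in `TargetCode.HasCertificate`; those for the target with index `j`
are of the kinds `2, …, 6`. -/
def certificateSystem (d r j : ℕ) (t : TargetCode) (ρ : ℕ) : List SparsePoly :=
  ((List.range t.1).flatMap fun i => (List.range r).map fun b =>
    ((List.range d).map fun a => ((t.2.2.getD i []).getD a 0, [entryVar 1 0 a b])) ++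
    (((List.range t.2.1.length).map fun e => ((t.2.1.getD e []).getD i 0, [entryVar 4 j e b])) ++
    ((List.range ρ).map fun a => ((-1 : ℤ), [entryVar 2 j i a, entryVar 3 j a b])))) ++
  (((List.range ρ).flatMap fun a => (List.range t.2.1.length).map fun e =>
    (List.range t.1).map fun i => ((t.2.1.getD e []).getD i 0, [entryVar 5 j a i])) ++
  (((List.range ρ).flatMap fun a => (List.range ρ).map fun b =>
    ((List.range t.1).map fun i => ((1 : ℤ), [entryVar 5 j a i, entryVar 2 j i b])) ++
      [(if a = b then -1 else 0, [])]) ++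
  ((List.range ρ).flatMap fun a => (List.range ρ).map fun b =>
    ((List.range r).map fun i => ((1 : ℤ), [entryVar 3 j a i, entryVar 6 j i b])) ++
      [(if a = b then -1 else 0, [])])))

/-- A sparse system that is solvable if and only if the tuple `x.2` is realized by a subgroup, for
the coded datum `x.1`. -/
def rankSystem (x : DatumCode × ℕ × List ℕ) : List SparsePoly :=
  leftInverseSystem x.1.1 x.2.1 ++ (List.range x.1.2.length).flatMap fun j =>
    certificateSystem x.1.1 x.2.1 j (x.1.2.getD j (0, [], [])) (x.2.2.getD j 0)

theorem primrec_leftInverseSystem : Primrec fun x : ℕ × ℕ => leftInverseSystem x.1 x.2 := by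
  unfold leftInverseSystem entryVar
  fun_prop

theorem primrec_certificateSystem : Primrec fun x : ℕ × ℕ × ℕ × TargetCode × ℕ =>
    certificateSystem x.1 x.2.1 x.2.2.1 x.2.2.2.1 x.2.2.2.2 := by
  unfold certificateSystem entryVar
  refine primrec_list_append ?_ (primrec_list_append ?_ (primrec_list_append ?_ ?_)) <;> fun_prop

theorem primrec_rankSystem : Primrec rankSystem := by
  have h1 : Primrec fun x : DatumCode × ℕ × List ℕ => leftInverseSystem x.1.1 x.2.1 :=
    primrec_leftInverseSystem.comp (f := fun x : ℕ × ℕ => leftInverseSystem x.1 x.2)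
      (g := fun x : DatumCode × ℕ × List ℕ => (x.1.1, x.2.1)) (by fun_prop)
  have h2 : Primrec fun p : (DatumCode × ℕ × List ℕ) × ℕ => certificateSystem p.1.1.1 p.1.2.1 p.2
      (p.1.1.2.getD p.2 (0, [], [])) (p.1.2.2.getD p.2 0) :=
    primrec_certificateSystem.comp (g := fun p : (DatumCode × ℕ × List ℕ) × ℕ =>
      (p.1.1.1, p.1.2.1, p.2, p.1.1.2.getD p.2 (0, [], []), p.1.2.2.getD p.2 0)) (by fun_prop)
  exact primrec_list_append h1 (primrec_list_flatMap (by fun_prop) h2)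

/-- The matrix of kind `k` for the target with index `j`. -/
def entryMatrix (x : ℕ → ℚ) (k j m n : ℕ) : Matrix (Fin m) (Fin n) ℚ :=
  Matrix.of fun a b => x (entryVar k j a b)

theorem forall_mem_grid {α : Type*} (m n : ℕ) (f : ℕ → ℕ → α) (P : α → Prop) :
    (∀ p ∈ (List.range m).flatMap fun a => (List.range n).map fun b => f a b, P p) ↔
      ∀ (a : Fin m) (b : Fin n), P (f a b) := by
  simp only [List.mem_flatMap, List.mem_map, List.mem_range, Fin.forall_iff]
  constructor
  · exact fun h a ha b hb => h _ ⟨a, ha, b, hb, rfl⟩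
  · rintro h _ ⟨a, ha, b, hb, rfl⟩
    exact h a ha b hb

/-- The constant term -1 appears on the diagonal only. The same shape expresses B'B = 1, LC = 1 and
DU = 1. -/
theorem mul_entryMatrix_eq_one_iff (x : ℕ → ℚ) (k j k' j' m n : ℕ) :
    (∀ p ∈ (List.range m).flatMap fun a => (List.range m).map fun b =>
      ((List.range n).map fun i => ((1 : ℤ), [entryVar k j a i, entryVar k' j' i b])) ++
        [(if a = b then -1 else 0, [])], SparsePoly.eval x p = 0) ↔
      entryMatrix x k j m n * entryMatrix x k' j' n m = 1 := by
  rw [forall_mem_grid, ← Matrix.ext_iff]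
  refine forall₂_congr fun a b => ?_
  rw [SparsePoly.eval_append, SparsePoly.eval_map_range, Matrix.mul_apply, Matrix.one_apply]
  by_cases hab : a = b
  · simp [hab, entryMatrix, ← sub_eq_add_neg, sub_eq_zero]
  · simp [hab, Fin.val_inj, entryMatrix]

theorem leftInverseSystem_iff (x : ℕ → ℚ) (d r : ℕ) :
    (∀ p ∈ leftInverseSystem d r, SparsePoly.eval x p = 0) ↔
      entryMatrix x 0 0 r d * entryMatrix x 1 0 d r = 1 :=
  mul_entryMatrix_eq_one_iff x 0 0 1 0 r d

theorem certificateSystem_iff (x : ℕ → ℚ) (d r j : ℕ) (t : TargetCode) (ρ : ℕ) :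
    (∀ p ∈ certificateSystem d r j t ρ, SparsePoly.eval x p = 0) ↔
      (mat t.1 d t.2.2).map (Int.cast : ℤ → ℚ) * entryMatrix x 1 0 d r +
        t.relationMatrix.map (Int.cast : ℤ → ℚ) * entryMatrix x 4 j t.2.1.length r =
        entryMatrix x 2 j t.1 ρ * entryMatrix x 3 j ρ r ∧
      entryMatrix x 5 j ρ t.1 * t.relationMatrix.map (Int.cast : ℤ → ℚ) = 0 ∧
      entryMatrix x 5 j ρ t.1 * entryMatrix x 2 j t.1 ρ = 1 ∧
      entryMatrix x 3 j ρ r * entryMatrix x 6 j r ρ = 1 := by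
  unfold certificateSystem
  rw [List.forall_mem_append, List.forall_mem_append, List.forall_mem_append,
    mul_entryMatrix_eq_one_iff, mul_entryMatrix_eq_one_iff, forall_mem_grid, forall_mem_grid]
  refine and_congr ?_ (and_congr ?_ Iff.rfl)
  · rw [← Matrix.ext_iff]
    refine forall₂_congr fun i b => ?_
    rw [SparsePoly.eval_append, SparsePoly.eval_append, SparsePoly.eval_map_range,
      SparsePoly.eval_map_range, SparsePoly.eval_map_range, Matrix.add_apply, Matrix.mul_apply,
      Matrix.mul_apply, Matrix.mul_apply]
    simp only [entryMatrix, mat, vec, TargetCode.relationMatrix, Matrix.of_apply, Matrix.map_apply,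
      List.map_cons, List.map_nil, List.prod_cons, List.prod_nil, mul_one, Int.cast_neg,
      Int.cast_one, neg_mul, one_mul, Finset.sum_neg_distrib]
    constructor <;> intro h <;> linarith
  · rw [← Matrix.ext_iff]
    refine forall₂_congr fun a e => ?_
    rw [SparsePoly.eval_map_range, Matrix.mul_apply]
    simp [entryMatrix, TargetCode.relationMatrix, mul_comm]

/-- The extension of a matrix by zero. -/
def extendMatrix {m n : ℕ} (A : Matrix (Fin m) (Fin n) ℚ) (a b : ℕ) : ℚ :=
  if h : a < m ∧ b < n then A ⟨a, h.1⟩ ⟨b, h.2⟩ else 0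

theorem extendMatrix_val {m n : ℕ} (A : Matrix (Fin m) (Fin n) ℚ) (a : Fin m) (b : Fin n) :
    extendMatrix A a b = A a b := dif_pos ⟨a.2, b.2⟩

/-- Unpairing recovers kind, target and position from a variable, so the entries of all matrices can
be prescribed independently. -/
theorem exists_entryMatrix_eq (X : ℕ → ℕ → ℕ → ℕ → ℚ) :
    ∃ x : ℕ → ℚ, ∀ k j m n, entryMatrix x k j m n =
      Matrix.of fun (a : Fin m) (b : Fin n) => X k j a b := by
  refine ⟨fun n => X n.unpair.1 n.unpair.2.unpair.1 n.unpair.2.unpair.2.unpair.1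
    n.unpair.2.unpair.2.unpair.2, fun k j m n => ?_⟩
  ext a b
  simp [entryMatrix, entryVar]

/-- The matrices of kinds 0 and 1 are shared by all targets, whereas each target has its own
certificate. -/
theorem sparseSolvable_rankSystem_iff (x : DatumCode × ℕ × List ℕ) :
    SparseSolvable (rankSystem x) ↔
      ∃ (B : Matrix (Fin x.1.1) (Fin x.2.1) ℚ) (B' : Matrix (Fin x.2.1) (Fin x.1.1) ℚ),
        B' * B = 1 ∧ ∀ j < x.1.2.length,
          TargetCode.HasCertificate B (x.1.2.getD j (0, [], [])) (x.2.2.getD j 0) := by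
  have hsplit : ∀ y : ℕ → ℚ, (∀ p ∈ rankSystem x, SparsePoly.eval y p = 0) ↔
      (∀ p ∈ leftInverseSystem x.1.1 x.2.1, SparsePoly.eval y p = 0) ∧
      ∀ j < x.1.2.length, ∀ p ∈ certificateSystem x.1.1 x.2.1 j (x.1.2.getD j (0, [], []))
        (x.2.2.getD j 0), SparsePoly.eval y p = 0 := by
    intro y
    unfold rankSystem
    rw [List.forall_mem_append]
    refine and_congr Iff.rfl ⟨fun h j hj p hp =>
      h p (List.mem_flatMap.2 ⟨j, List.mem_range.2 hj, hp⟩), fun h p hp => ?_⟩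
    obtain ⟨j, hj, hp⟩ := List.mem_flatMap.1 hp
    exact h j (List.mem_range.1 hj) p hp
  constructor
  · rintro ⟨y, hy⟩
    obtain ⟨h1, h2⟩ := (hsplit y).1 hy
    refine ⟨_, _, (leftInverseSystem_iff _ _ _).1 h1, fun j hj => ?_⟩
    exact ⟨_, _, _, _, _, (certificateSystem_iff _ _ _ _ _ _).1 (h2 j hj)⟩
  · rintro ⟨B, B', hB, hcert⟩
    choose C D E L U h using hcert
    obtain ⟨y, hy⟩ := exists_entryMatrix_eq fun k j a b => match k with
      | 0 => extendMatrix B' a b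
      | 1 => extendMatrix B a b
      | 2 => if hj : j < x.1.2.length then extendMatrix (C j hj) a b else 0
      | 3 => if hj : j < x.1.2.length then extendMatrix (D j hj) a b else 0
      | 4 => if hj : j < x.1.2.length then extendMatrix (E j hj) a b else 0
      | 5 => if hj : j < x.1.2.length then extendMatrix (L j hj) a b else 0
      | _ => if hj : j < x.1.2.length then extendMatrix (U j hj) a b else 0
    have h0 : entryMatrix y 0 0 _ _ = B' := by
      rw [hy]
      ext a b
      exact extendMatrix_val _ _ _
    have h1 : entryMatrix y 1 0 _ _ = B := by
      rw [hy]
      ext a b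
      exact extendMatrix_val _ _ _
    refine ⟨y, (hsplit y).2 ⟨(leftInverseSystem_iff _ _ _).2 (by rw [h0, h1, hB]),
      fun j hj => (certificateSystem_iff _ _ _ _ _ _).2 ?_⟩⟩
    have h2 : entryMatrix y 2 j _ _ = C j hj := by
      rw [hy]
      ext a b
      exact (dif_pos hj).trans (extendMatrix_val _ _ _)
    have h3 : entryMatrix y 3 j _ _ = D j hj := by
      rw [hy]
      ext a b
      exact (dif_pos hj).trans (extendMatrix_val _ _ _)
    have h4 : entryMatrix y 4 j _ _ = E j hj := by
      rw [hy]
      ext a b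
      exact (dif_pos hj).trans (extendMatrix_val _ _ _)
    have h5 : entryMatrix y 5 j _ _ = L j hj := by
      rw [hy]
      ext a b
      exact (dif_pos hj).trans (extendMatrix_val _ _ _)
    have h6 : entryMatrix y 6 j _ _ = U j hj := by
      rw [hy]
      ext a b
      exact (dif_pos hj).trans (extendMatrix_val _ _ _)
    rw [h1, h2, h3, h4, h5, h6]
    exact h j hj

/-- The system reads `ρ` with default 0 and ignores surplus entries, so it does not see the length
of `ρ`, which has to be prescribed. -/
theorem sparseSolvable_rankSystem_iff_mem (c : DatumCode) (r : ℕ) (ρ : List ℕ)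
    (hρ : ρ.length = c.2.length) :
    SparseSolvable (rankSystem (c, r, ρ)) ↔
      (r, ρ) ∈ (fun p : ℕ × (Fin c.toDatum.m → ℕ) => (p.1, List.ofFn p.2)) ''
        c.toDatum.rankTuples := by
  rw [sparseSolvable_rankSystem_iff]
  refine Iff.trans ?_ (mem_image_rankTuples_iff c.1 c.2 r ρ).symm
  rw [exists_addSubgroup_iff_exists_matrix, and_iff_right hρ]
  refine exists_congr fun B => exists_congr fun B' => and_congr Iff.rfl ?_
  rw [Fin.forall_iff]
  refine forall₂_congr fun j hj => ?_
  rw [List.getD_eq_getElem _ _ hj]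
  rfl

/-! ### Enumeration of the candidates for realized tuples -/

/-- The lists of length `m` with entries less than `b`. -/
def boundedLists (b m : ℕ) : List (List ℕ) :=
  Nat.rec [[]] (fun _ acc => acc.flatMap fun l => (List.range b).map fun a => a :: l) m

theorem mem_boundedLists {b m : ℕ} {l : List ℕ} :
    l ∈ boundedLists b m ↔ l.length = m ∧ ∀ a ∈ l, a < b := by
  induction m generalizing l with
  | zero =>
    change l ∈ [[]] ↔ _
    rw [List.mem_singleton, List.length_eq_zero_iff]
    constructor
    · rintro rfl
      simp
    · exact And.left
  | succ m ih =>
    change l ∈ (boundedLists b m).flatMap (fun l => (List.range b).map fun a => a :: l) ↔ _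
    simp only [List.mem_flatMap, List.mem_map, List.mem_range, ih]
    constructor
    · rintro ⟨l, ⟨rfl, hl⟩, a, ha, rfl⟩
      simpa using ⟨ha, hl⟩
    · rintro ⟨hlen, hl⟩
      obtain ⟨a, l, rfl⟩ := List.exists_cons_of_length_eq_add_one hlen
      rw [List.forall_mem_cons] at hl
      exact ⟨l, ⟨by simpa using hlen, hl.2⟩, a, hl.1, rfl⟩

/-- A finite list that contains all tuples realized by subgroups, for a coded datum. -/
def candidateTuples (c : DatumCode) : List (ℕ × List ℕ) :=
  (List.range (c.1 + 1)).flatMap fun r =>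
    (boundedLists (c.1 + 1) c.2.length).map fun l => (r, l)

theorem primrec_boundedLists {α : Type*} [Primcodable α] {f g : α → ℕ} (hf : Primrec f)
    (hg : Primrec g) : Primrec fun a => boundedLists (f a) (g a) := by
  refine Primrec.nat_rec' hg (Primrec.const [[]])
    (h := fun a p => p.2.flatMap fun l => (List.range (f a)).map fun a => a :: l) ?_
  unfold Primrec₂
  fun_prop

theorem primrec_candidateTuples : Primrec candidateTuples := by
  have h : Primrec fun p : DatumCode × ℕ => boundedLists (p.1.1 + 1) p.1.2.length :=
    primrec_boundedLists (by fun_prop) (by fun_prop)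
  refine primrec_list_flatMap (by fun_prop) ?_
  fun_prop

theorem mem_candidateTuples {c : DatumCode} {r : ℕ} {ρ : List ℕ} :
    (r, ρ) ∈ candidateTuples c ↔ r ≤ c.1 ∧ ρ.length = c.2.length ∧ ∀ a ∈ ρ, a ≤ c.1 := by
  simp [candidateTuples, mem_boundedLists]

/-- Every rank is the dimension of a subspace of ℚᵈ or of a linear image of one, hence at most d. -/
theorem mem_candidateTuples_of_mem_image {c : DatumCode} {r : ℕ} {ρ : List ℕ}
    (h : (r, ρ) ∈ (fun p : ℕ × (Fin c.toDatum.m → ℕ) => (p.1, List.ofFn p.2)) ''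
      c.toDatum.rankTuples) : (r, ρ) ∈ candidateTuples c := by
  obtain ⟨H, rfl, rfl⟩ := (mem_image_rankTuples_iff c.1 c.2 r ρ).1 h
  have hH : finrank ℚ (rationalSpan H) ≤ c.1 :=
    (Submodule.finrank_le _).trans (by simp)
  refine mem_candidateTuples.2 ⟨(finrank_eq_finrank_rationalSpan H).trans_le hH,
    List.length_map _, fun a ha => ?_⟩
  obtain ⟨t, -, rfl⟩ := List.mem_map.1 ha
  rw [TargetCode.imageRank_eq]
  exact (Submodule.finrank_map_le _ _).trans hH

/-- The decision procedure for sparse systems is run on `rankSystem` for each of the finitely many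
candidates. -/
theorem rankTuplesComputable_of_sparse (h : ComputablePred SparseSolvable) :
    RankTuplesComputable := by
  obtain ⟨f, hf, hfS⟩ := ComputablePred.computable_iff.1 h
  refine ⟨fun c => (candidateTuples c).filter fun x => f (rankSystem (c, x)),
    computable_filter (p := fun c x => f (rankSystem (c, x))) primrec_candidateTuples.to_comp
      (hf.comp primrec_rankSystem.to_comp), fun c => ?_⟩
  ext ⟨r, ρ⟩
  have key : (r, ρ) ∈ candidateTuples c → (f (rankSystem (c, r, ρ)) = true ↔
      (r, ρ) ∈ (fun p : ℕ × (Fin c.toDatum.m → ℕ) => (p.1, List.ofFn p.2)) ''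
        c.toDatum.rankTuples) := fun hc => by
    rw [← sparseSolvable_rankSystem_iff_mem c r ρ (mem_candidateTuples.1 hc).2.1, hfS]
  change (r, ρ) ∈ List.filter _ _ ↔ _
  rw [List.mem_filter]
  constructor
  · rintro ⟨hc, hx⟩
    exact (key hc).1 hx
  · intro hx
    have hc := mem_candidateTuples_of_mem_image hx
    exact ⟨hc, (key hc).2 hx⟩

end HBL

theorem theorem4 :
    (HBL.RankTuplesComputable ↔ HBL.HilbertTenthRatDecidable) ∧
    ∀ (t s k l : ℕ) (S : HBL.BasicSystem (t + s) k l),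
      (∀ i x y, Computable fun a : Fin t → HBL.RatCode => S.matrices a i x y) ∧
      ∀ a : Fin t → HBL.RatCode,
        (∃ b : Fin s → ℚ, Fin.append (fun j => (a j).toRat) b ∈ HBL.rationalZeros S.polys) ↔
          S.matrices a ∈ HBL.matrixRealizers 2 HBL.MatrixIndex.rank := by
  rw [HBL.hilbertTenthRatDecidable_iff_sparse]
  exact ⟨⟨HBL.computablePred_sparseSolvable_of_rankTuplesComputable,
    HBL.rankTuplesComputable_of_sparse⟩, fun t s k l S =>
    ⟨S.computable_matrices, S.exists_append_mem_rationalZeros_iff⟩⟩
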